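/- All vector spaces are real. A cone in a vector space is a subset closed under addition and under multiplication by non-negative scalars; a linear map $T$ is positive if it maps the cone of its domain into the cone of its codomain, and bipositive if moreover it is injective and every element whose image under $T$ is positive is itself positive. For a Banach space $X$ with a cone $X_+$, $B(X)$ carries the cone $B(X)_+=\{T: TX_+\subseteq X_+\}$. The completion of a (semi)normed space with a cone carries the closure of (the image of) that cone. Let $A$ be a Banach algebra (not necessarily unital) with a closed cone $A_+$ such that $A_+A_+\subseteq A_+$. Let $G$ be a locally compact Hausdorff group with left Haar measure, and let $\alpha$ be a strongly continuous homomorphism from $G$ to the group of bounded algebra automorphisms of $A$ that preserve $A_+$ together with their inverses. Assume $\alpha$ is uniformly bounded, $\sup_{s}\|\alpha_s\|<\infty$, and let $\omega:G\to[0,\infty)$ be a weight, i.e. a non-zero submultiplicative Borel measurable function. On $C_c(G,A)$ consider the cone $C_c(G,A_+)$ and the twisted convolution $[f*g](s)=\int_G f(r)\alpha_r(g(r^{-1}s))\,dr$. Let $L^1(G,A,\omega)$ be the completion of $C_c(G,A)$ in the norm $\|h\|_{1,\omega}=\int_G\|h(s)\|\omega(s)\,ds$; with the continuous extension of the twisted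 convolution as multiplication it is the pre-ordered generalized Beurling algebra $L^1(G,A,\omega;\alpha)$. Let $\tilde\lambda(a)$ $(a\in A)$ and $\Lambda_r$ $(r\in G)$ be the bounded operators on $L^1(G,A,\omega)$ given on $C_c(G,A)$ by $[\tilde\lambda(a)h](s)=\alpha_s^{-1}(a)h(s)$ and $(\Lambda_rh)(s)=h(r^{-1}s)$; then $(\tilde\lambda,\Lambda)$ is a continuous covariant representation of $(A,G,\alpha)$ on $L^1(G,A,\omega)$, with integrated form $\tilde\lambda\rtimes\Lambda(f)x=\int_G\tilde\lambda(f(r))\Lambda_rx\,dr$ for $f\in C_c(G,A)$, $x\in L^1(G,A,\omega)$. For a uniformly bounded class $\mathcal R$ of continuous covariant representations on Banach spaces, the pre-ordered crossed product $(A\rtimes_\alpha G)^{\mathcal R}$ is the completion of $C_c(G,A)/\ker\sigma^{\mathcal R}$, where $\sigma^{\mathcal R}(f)=\sup_{(\pi,U)\in\mathcal R}\|\pi\rtimes U(f)\|$, with the multiplication induced by the twisted convolution and the cone induced by $C_c(G,A_+)$. Put $\mathcal R:=\{(\tilde\lambda,\Lambda)\}$. **Theorem 5.8.** Assume in addition that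 $A$ has a (not necessarily positive) bounded approximate right identity. Then $(\tilde\lambda,\Lambda)$ is positive and non-degenerate, and the following hold. 1. There is a bipositive topological isomorphism of algebras $\Phi$ from $L^1(G,A,\omega;\alpha)$ onto $(A\rtimes_\alpha G)^{\mathcal R}$ that is the identity on $C_c(G,A)$. 2. The map $\tilde\lambda\rtimes\Lambda:C_c(G,A)\to B(L^1(G,A,\omega))$ extends to a positive topological embedding of algebras $\Psi:(A\rtimes_\alpha G)^{\mathcal R}\to B(L^1(G,A,\omega))$. If $A$ has a bounded approximate right identity consisting of positive elements, then $\Psi$ is bipositive. 3. If $A$ has a $1$-bounded approximate right identity, every $\alpha_s$ is an isometry of $A$, and $\inf_{W\in\mathcal Z}\sup_{r\in W}\omega(r)=1$, where $\mathcal Z$ is a neighbourhood base of $e\in G$ all of whose elements are contained in a fixed compact set, then $\Phi$ and $\Psi$ are both isometric. -/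

import Mathlib

open MeasureTheory Filter Topology Set
open scoped CompactlySupported Pointwise

set_option linter.unusedSectionVars false

noncomputable section

namespace OrderedCrossedProduct

/-! ### Completion of a pre-ordered seminormed space -/

section Completion

variable {V : Type*} [AddCommGroup V] [Module ℝ V]

/-- The vector space `V` regarded as a seminormed space with the seminorm `p`. -/
def WithSeminorm (_p : Seminorm ℝ V) : Type _ := V

variable (p : Seminorm ℝ V)

instance : SeminormedAddCommGroup (WithSeminorm p) :=
  AddGroupSeminorm.toSeminormedAddCommGroup (E := V) p.toAddGroupSeminorm

instance : NormedSpace ℝ (WithSeminorm p) where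
  toModule := inferInstanceAs (Module ℝ V)
  norm_smul_le r v := (map_smul_eq_mul p r v).le

/-- The identity map of `V`, as a linear map into `WithSeminorm p`. -/
def toWithSeminorm : V →ₗ[ℝ] WithSeminorm p where
  toFun v := v
  map_add' _ _ := rfl
  map_smul' _ _ := rfl

/-- The Banach space obtained from `V` and a seminorm `p`: the (Hausdorff) completion of `(V, p)`,
that is, the completion of the normed space `V / ker p`. -/
abbrev Compl : Type _ := UniformSpace.Completion (WithSeminorm p)

/-- The canonical map of `V` into its completion (the quotient map `V → V / ker p` followed by the
inclusion into the completion). -/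
def toCompl : V →ₗ[ℝ] Compl p :=
  (UniformSpace.Completion.toComplL (𝕜 := ℝ) (E := WithSeminorm p)).toLinearMap.comp
    (toWithSeminorm p)

theorem norm_toCompl (v : V) : ‖toCompl p v‖ = p v :=
  UniformSpace.Completion.norm_coe (E := WithSeminorm p) v

theorem denseRange_toCompl : DenseRange (toCompl p) :=
  UniformSpace.Completion.denseRange_coe (α := WithSeminorm p)

/-- The cone of the completion: the closure of the image of the cone of `V`. -/
def complCone (C : PointedCone ℝ V) : PointedCone ℝ (Compl p) :=
  PointedCone.closure (PointedCone.map (toCompl p) C)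

/-- The extension to the completion of a linear map into a Banach space that is bounded with
respect to `p`. -/
def extendCompl {Y : Type*} [NormedAddCommGroup Y] [NormedSpace ℝ Y] [CompleteSpace Y]
    (T : V →ₗ[ℝ] Y) : Compl p →L[ℝ] Y := T.extendOfNorm (toCompl p)

theorem extendCompl_toCompl {Y : Type*} [NormedAddCommGroup Y] [NormedSpace ℝ Y] [CompleteSpace Y]
    (T : V →ₗ[ℝ] Y) (h : ∃ C, ∀ v, ‖T v‖ ≤ C * p v) (v : V) :
    extendCompl p T (toCompl p v) = T v :=
  LinearMap.extendOfNorm_eq (denseRange_toCompl p) (by simpa only [norm_toCompl] using h) v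

theorem norm_extendCompl_le {Y : Type*} [NormedAddCommGroup Y] [NormedSpace ℝ Y] [CompleteSpace Y]
    (T : V →ₗ[ℝ] Y) {C : ℝ} (hC : 0 ≤ C) (h : ∀ v, ‖T v‖ ≤ C * p v) : ‖extendCompl p T‖ ≤ C :=
  LinearMap.opNorm_extendOfNorm_le (denseRange_toCompl p) hC (by simpa only [norm_toCompl] using h)

theorem ext_compl {Y : Type*} [NormedAddCommGroup Y] [NormedSpace ℝ Y]
    {S T : Compl p →L[ℝ] Y} (h : ∀ v, S (toCompl p v) = T (toCompl p v)) : S = T := by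
  refine ContinuousLinearMap.coeFn_injective ?_
  exact (denseRange_toCompl p).equalizer S.continuous T.continuous (funext h)

/-- The operator on the completion that extends a `p`-bounded linear operator on `V`. -/
def mapCompl (T : V →ₗ[ℝ] V) : Compl p →L[ℝ] Compl p := extendCompl p ((toCompl p).comp T)

theorem mapCompl_toCompl (T : V →ₗ[ℝ] V) (h : ∃ C, ∀ v, p (T v) ≤ C * p v) (v : V) :
    mapCompl p T (toCompl p v) = toCompl p (T v) :=
  extendCompl_toCompl p _ (by simpa [norm_toCompl] using h) v

theorem norm_mapCompl_le (T : V →ₗ[ℝ] V) {C : ℝ} (hC : 0 ≤ C) (h : ∀ v, p (T v) ≤ C * p v) :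
    ‖mapCompl p T‖ ≤ C :=
  norm_extendCompl_le p _ hC (by simpa [norm_toCompl] using h)

/-- For `v : V`, the continuous extension of `w ↦ m v w` to the completion, linearly in `v`. -/
def mulComplAux (m : V →ₗ[ℝ] V →ₗ[ℝ] V) (hm : ∃ C, 0 ≤ C ∧ ∀ v w, p (m v w) ≤ C * p v * p w) :
    V →ₗ[ℝ] (Compl p →L[ℝ] Compl p) where
  toFun v := mapCompl p (m v)
  map_add' v₁ v₂ := by
    obtain ⟨C, -, hC⟩ := hm
    refine ext_compl p fun w => ?_
    rw [add_apply, mapCompl_toCompl p _ ⟨_, hC _⟩,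
      mapCompl_toCompl p _ ⟨_, hC _⟩, mapCompl_toCompl p _ ⟨_, hC _⟩]
    simp
  map_smul' r v := by
    obtain ⟨C, -, hC⟩ := hm
    refine ext_compl p fun w => ?_
    rw [smul_apply, mapCompl_toCompl p _ ⟨_, hC _⟩,
      mapCompl_toCompl p _ ⟨_, hC _⟩]
    simp

/-- The continuous bilinear extension to the completion of a bilinear multiplication `m` on `V`
that is bounded with respect to `p`. -/
def mulCompl (m : V →ₗ[ℝ] V →ₗ[ℝ] V) (hm : ∃ C, 0 ≤ C ∧ ∀ v w, p (m v w) ≤ C * p v * p w) :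
    Compl p →L[ℝ] Compl p →L[ℝ] Compl p := extendCompl p (mulComplAux p m hm)

theorem mulCompl_toCompl (m : V →ₗ[ℝ] V →ₗ[ℝ] V)
    (hm : ∃ C, 0 ≤ C ∧ ∀ v w, p (m v w) ≤ C * p v * p w) (v w : V) :
    mulCompl p m hm (toCompl p v) (toCompl p w) = toCompl p (m v w) := by
  obtain ⟨C, hC0, hC⟩ := id hm
  rw [mulCompl, extendCompl_toCompl p _ ⟨C, fun v => ?_⟩]
  · exact mapCompl_toCompl p _ ⟨_, hC v⟩ w
  · exact norm_mapCompl_le p _ (mul_nonneg hC0 (apply_nonneg p v)) (hC v)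

end Completion

/-! ### Compactly supported continuous functions -/

section Cc

variable {G : Type*} [TopologicalSpace G]

/-- The cone `C_c(G, X₊)` of `C_c(G, X)`. -/
def ccCone {X : Type*} [NormedAddCommGroup X] [NormedSpace ℝ X] (C : PointedCone ℝ X) :
    PointedCone ℝ C_c(G, X) where
  carrier := {f | ∀ s, f s ∈ C}
  add_mem' hf hg s := C.add_mem (hf s) (hg s)
  zero_mem' _ := C.zero_mem
  smul_mem' c _ hf s := C.smul_mem' c (hf s)

end Cc

section Strong

variable {G : Type*} [TopologicalSpace G]
  {X : Type*} [NormedAddCommGroup X] [NormedSpace ℝ X] [CompleteSpace X]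

theorem bddOn_compact_of_strong {U : G → X →L[ℝ] X} (hU : ∀ x, Continuous fun s => U s x)
    {K : Set G} (hK : IsCompact K) : ∃ C, 0 ≤ C ∧ ∀ s ∈ K, ‖U s‖ ≤ C := by
  obtain ⟨C, hC⟩ := banach_steinhaus (g := fun s : K => U s) fun x => by
    obtain ⟨C, hC⟩ := hK.exists_bound_of_continuousOn (hU x).continuousOn
    exact ⟨C, fun s => hC s s.2⟩
  exact ⟨max C 0, le_max_right _ _, fun s hs => (hC ⟨s, hs⟩).trans (le_max_left _ _)⟩

theorem continuous_uncurry_of_strong [LocallyCompactSpace G] {U : G → X →L[ℝ] X}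
    (hU : ∀ x, Continuous fun s => U s x) : Continuous fun q : G × X => U q.1 q.2 := by
  rw [continuous_iff_continuousAt]
  rintro ⟨s₀, x₀⟩
  obtain ⟨K, hK, hKn⟩ := exists_compact_mem_nhds s₀
  obtain ⟨C, hC0, hC⟩ := bddOn_compact_of_strong hU hK
  rw [ContinuousAt, tendsto_iff_norm_sub_tendsto_zero]
  have h1 : Tendsto (fun q : G × X => C * ‖q.2 - x₀‖ + ‖U q.1 x₀ - U s₀ x₀‖)
      (𝓝 (s₀, x₀)) (𝓝 0) := by
    have : Continuous (fun q : G × X => C * ‖q.2 - x₀‖ + ‖U q.1 x₀ - U s₀ x₀‖) := by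
      have := (hU x₀).comp (continuous_fst (X := G) (Y := X))
      simp only [Function.comp_def] at this
      fun_prop
    simpa using this.tendsto (s₀, x₀)
  refine squeeze_zero' (Eventually.of_forall fun _ => norm_nonneg _) ?_ h1
  filter_upwards [continuousAt_fst.preimage_mem_nhds (x := (s₀, x₀)) hKn] with q hq
  calc ‖U q.1 q.2 - U s₀ x₀‖ = ‖U q.1 (q.2 - x₀) + (U q.1 x₀ - U s₀ x₀)‖ := by
        rw [map_sub]; congr 1; abel
    _ ≤ ‖U q.1 (q.2 - x₀)‖ + ‖U q.1 x₀ - U s₀ x₀‖ := norm_add_le _ _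
    _ ≤ _ := by gcongr; exact (U q.1).le_of_opNorm_le (hC _ hq) _

end Strong


/-! ### Weights and the spaces `L¹(G, X, ω)` -/

/-- A weight on `G`: a non-zero submultiplicative Borel measurable function `ω : G → [0, ∞)`. -/
structure Weight (G : Type*) [Group G] [MeasurableSpace G] where
  toFun : G → ℝ
  nonneg' : ∀ s, 0 ≤ toFun s
  measurable' : Measurable toFun
  mul_le' : ∀ s t, toFun (s * t) ≤ toFun s * toFun t
  ne_zero' : ∃ s, toFun s ≠ 0

instance (G : Type*) [Group G] [MeasurableSpace G] : CoeFun (Weight G) fun _ => G → ℝ :=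
  ⟨Weight.toFun⟩

section Beurling

variable {G : Type*} [Group G] [TopologicalSpace G] [IsTopologicalGroup G] [LocallyCompactSpace G] [T2Space G]
  [MeasurableSpace G] [BorelSpace G]

/-- A weight is bounded on compact sets. -/
theorem Weight.bddOn_compact (μ : Measure G) [μ.IsHaarMeasure] [μ.Regular] (ω : Weight G)
    {K : Set G} (hK : IsCompact K) : ∃ C, 0 ≤ C ∧ ∀ s ∈ K, ω s ≤ C := by
  -- a neighbourhood of the identity on which the weight is bounded, by the Steinhaus theorem
  obtain ⟨L, hL, hLn⟩ := exists_compact_mem_nhds (1 : G)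
  let E : ℕ → Set G := fun n => {s | ω s ≤ n ∧ ω s⁻¹ ≤ n}
  have hE : ∀ n, MeasurableSet (E n) := fun n =>
    (measurableSet_le ω.measurable' measurable_const).inter
      (measurableSet_le (ω.measurable'.comp measurable_inv) measurable_const)
  have hU : ⋃ n, E n = univ := by
    refine eq_univ_of_forall fun s => mem_iUnion.2 ?_
    obtain ⟨n, hn⟩ := exists_nat_ge (max (ω s) (ω s⁻¹))
    exact ⟨n, (le_max_left _ _).trans hn, (le_max_right _ _).trans hn⟩
  have hpos : ∃ n, 0 < μ (E n ∩ interior L) := by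
    by_contra! h
    have h0 : μ (⋃ n, E n ∩ interior L) = 0 := measure_iUnion_null fun n => le_antisymm (h n) bot_le
    rw [← iUnion_inter, hU, univ_inter] at h0
    exact (isOpen_interior.measure_pos μ ⟨1, mem_interior_iff_mem_nhds.2 hLn⟩).ne' h0
  obtain ⟨n, hn⟩ := hpos
  have hfin : μ (E n ∩ interior L) ≠ ⊤ :=
    ((measure_mono (inter_subset_right.trans interior_subset)).trans_lt hL.measure_lt_top).ne
  have hV := Measure.div_mem_nhds_one_of_haar_pos_ne_top μ _
    ((hE n).inter isOpen_interior.measurableSet) hn hfin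
  have hVb : ∀ v ∈ (E n ∩ interior L) / (E n ∩ interior L), ω v ≤ n * n := by
    rintro _ ⟨a, ha, b, hb, rfl⟩
    simp only [div_eq_mul_inv]
    exact (ω.mul_le' a b⁻¹).trans
      (mul_le_mul ha.1.1 hb.1.2 (ω.nonneg' _) (Nat.cast_nonneg n))
  -- cover the compact set by finitely many translates
  obtain ⟨t, -, ht⟩ := hK.elim_nhds_subcover
    (fun x => (fun s => x⁻¹ * s) ⁻¹' ((E n ∩ interior L) / (E n ∩ interior L))) fun x _ => by
      refine (continuous_const_mul x⁻¹).continuousAt.preimage_mem_nhds ?_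
      simpa using hV
  refine ⟨∑ x ∈ t, ω x * (n * n), Finset.sum_nonneg fun x _ =>
    mul_nonneg (ω.nonneg' x) (by positivity), fun s hs => ?_⟩
  obtain ⟨x, hx, hxs⟩ := mem_iUnion₂.1 (ht hs)
  calc ω s = ω (x * (x⁻¹ * s)) := by rw [mul_inv_cancel_left]
    _ ≤ ω x * ω (x⁻¹ * s) := ω.mul_le' _ _
    _ ≤ ω x * (n * n) := mul_le_mul_of_nonneg_left (hVb _ hxs) (ω.nonneg' x)
    _ ≤ _ := Finset.single_le_sum (f := fun x => ω x * ((n : ℝ) * n))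
      (fun x _ => mul_nonneg (ω.nonneg' x) (by positivity)) hx

/-- The measure `ω dμ`. -/
def Weight.measure (μ : Measure G) (ω : Weight G) : Measure G :=
  μ.withDensity fun s => ENNReal.ofReal (ω s)

instance (μ : Measure G) [μ.IsHaarMeasure] [μ.Regular] (ω : Weight G) :
    IsFiniteMeasureOnCompacts (ω.measure μ) where
  lt_top_of_isCompact K hK := by
    obtain ⟨C, -, hC⟩ := ω.bddOn_compact μ hK
    rw [Weight.measure, withDensity_apply _ hK.measurableSet]
    calc ∫⁻ s in K, ENNReal.ofReal (ω s) ∂μ ≤ ∫⁻ _ in K, ENNReal.ofReal C ∂μ :=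
          setLIntegral_mono measurable_const fun s hs => ENNReal.ofReal_le_ofReal (hC s hs)
      _ < ⊤ := by
          rw [setLIntegral_const]
          exact ENNReal.mul_lt_top ENNReal.ofReal_lt_top hK.measure_lt_top

theorem Weight.integral_measure (μ : Measure G) (ω : Weight G) (g : G → ℝ) :
    ∫ s, g s ∂(ω.measure μ) = ∫ s, g s * ω s ∂μ := by
  rw [Weight.measure, integral_withDensity_eq_integral_toReal_smul
    ω.measurable'.ennreal_ofReal (Eventually.of_forall fun _ => ENNReal.ofReal_lt_top)]
  refine integral_congr_ae (Eventually.of_forall fun s => ?_)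
  simp [ENNReal.toReal_ofReal (ω.nonneg' s), mul_comm]

theorem integrable_norm_cc {X : Type*} [NormedAddCommGroup X] (ν : Measure G)
    [IsFiniteMeasureOnCompacts ν] (h : C_c(G, X)) : Integrable (fun s => ‖h s‖) ν :=
  (h.continuous.integrable_of_hasCompactSupport h.hasCompactSupport).norm

theorem Weight.integrable (μ : Measure G) [μ.IsHaarMeasure] [μ.Regular] (ω : Weight G)
    {X : Type*} [NormedAddCommGroup X] (h : C_c(G, X)) :
    Integrable (fun s => ‖h s‖ * ω s) μ := by
  have := integrable_norm_cc (ω.measure μ) h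
  rw [Weight.measure, integrable_withDensity_iff_integrable_smul' ω.measurable'.ennreal_ofReal
    (Eventually.of_forall fun _ => ENNReal.ofReal_lt_top)] at this
  refine this.congr (Eventually.of_forall fun s => ?_)
  simp [ENNReal.toReal_ofReal (ω.nonneg' s), mul_comm]

variable (μ : Measure G) [μ.IsHaarMeasure] [μ.Regular] (ω : Weight G)

/-- The weighted norm `‖h‖_{1,ω} = ∫ ‖h(s)‖ ω(s) ds` on `C_c(G, X)`. -/
def weightedNorm (X : Type*) [NormedAddCommGroup X] [NormedSpace ℝ X] : Seminorm ℝ C_c(G, X) :=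
  Seminorm.of (fun h => ∫ s, ‖h s‖ * ω s ∂μ)
    (fun f g => by
      rw [← integral_add (ω.integrable μ f) (ω.integrable μ g)]
      refine integral_mono (ω.integrable μ (f + g))
        ((ω.integrable μ f).add (ω.integrable μ g)) fun s => ?_
      simp only [← add_mul]
      exact mul_le_mul_of_nonneg_right (norm_add_le _ _) (ω.nonneg' s))
    (fun r f => by
      rw [← integral_const_mul]
      simp only [CompactlySupportedContinuousMap.smul_apply, norm_smul, mul_assoc])

theorem weightedNorm_apply {X : Type*} [NormedAddCommGroup X] [NormedSpace ℝ X] (h : C_c(G, X)) :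
    weightedNorm μ ω X h = ∫ s, ‖h s‖ * ω s ∂μ := rfl

theorem weightedNorm_apply' {X : Type*} [NormedAddCommGroup X] [NormedSpace ℝ X] (h : C_c(G, X)) :
    weightedNorm μ ω X h = ∫ s, ‖h s‖ ∂(ω.measure μ) := (ω.integral_measure μ _).symm

/-- The Banach space `L¹(G, X, ω)`: the completion of `C_c(G, X)` in the norm `‖·‖_{1,ω}`. -/
abbrev BeurlingSpace (X : Type*) [NormedAddCommGroup X] [NormedSpace ℝ X] : Type _ :=
  Compl (weightedNorm μ ω X)

/-- The inclusion `C_c(G, X) → L¹(G, X, ω)`. -/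
def toBeurling {X : Type*} [NormedAddCommGroup X] [NormedSpace ℝ X] :
    C_c(G, X) →ₗ[ℝ] BeurlingSpace μ ω X := toCompl (weightedNorm μ ω X)

/-- The cone `L¹(G, X, ω)₊`: the closure of `C_c(G, X₊)` in `L¹(G, X, ω)`. -/
def beurlingCone {X : Type*} [NormedAddCommGroup X] [NormedSpace ℝ X] (C : PointedCone ℝ X) :
    PointedCone ℝ (BeurlingSpace μ ω X) := complCone (weightedNorm μ ω X) (ccCone C)

end Beurling

/-! ### Pre-ordered Banach algebra dynamical systems -/

section System

variable (A G : Type*) [NonUnitalNormedRing A] [NormedSpace ℝ A] [IsScalarTower ℝ A A]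
  [SMulCommClass ℝ A A] [CompleteSpace A] [Group G] [TopologicalSpace G]

/-- A pre-ordered Banach algebra dynamical system `(A, G, α)`: the Banach algebra `A` carries a
closed cone with `A₊ · A₊ ⊆ A₊`, and `α` is a strongly continuous homomorphism from `G` to the
bounded bipositive automorphisms of `A`. (As `G` is a group, `α s` is invertible with inverse
`α s⁻¹`, so that positivity of all `α s` amounts to bipositivity.) -/
structure PreorderedSystem where
  cone : PointedCone ℝ A
  isClosed_cone : IsClosed (cone : Set A)
  mul_mem_cone : ∀ a ∈ cone, ∀ b ∈ cone, a * b ∈ cone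
  act : G →* (A →L[ℝ] A)
  act_mul : ∀ s a b, act s (a * b) = act s a * act s b
  continuous_act : ∀ a, Continuous fun s => act s a
  act_mem_cone : ∀ s, ∀ a ∈ cone, act s a ∈ cone

end System

section Crossed

variable {A G : Type*} [NonUnitalNormedRing A] [NormedSpace ℝ A] [IsScalarTower ℝ A A]
  [SMulCommClass ℝ A A] [CompleteSpace A] [Group G] [TopologicalSpace G] [IsTopologicalGroup G]
  [LocallyCompactSpace G] [T2Space G] [MeasurableSpace G] [BorelSpace G]

/-- The action `α` is uniformly bounded. -/
def PreorderedSystem.UniformlyBounded (S : PreorderedSystem A G) : Prop :=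
  ∃ C : ℝ, ∀ s, ‖S.act s‖ ≤ C

variable (μ : Measure G) [μ.IsHaarMeasure] [μ.Regular] (S : PreorderedSystem A G)

theorem PreorderedSystem.continuous_act_uncurry : Continuous fun q : G × A => S.act q.1 q.2 :=
  continuous_uncurry_of_strong S.continuous_act

theorem PreorderedSystem.act_act (s t : G) (a : A) : S.act s (S.act t a) = S.act (s * t) a := by
  rw [map_mul]; rfl

theorem PreorderedSystem.act_one (a : A) : S.act 1 a = a := by
  rw [map_one]; rfl

theorem continuous_convIntegrand (f g : C_c(G, A)) :
    Continuous fun q : G × G => f q.2 * S.act q.2 (g (q.2⁻¹ * q.1)) := by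
  refine (f.continuous.comp continuous_snd).mul (S.continuous_act_uncurry.comp
    (continuous_snd.prodMk (g.continuous.comp (continuous_snd.inv.mul continuous_fst))))

theorem convIntegrand_eq_zero (f g : C_c(G, A)) {s r : G} (h : r ∉ tsupport f ∨
    s ∉ tsupport f * tsupport g) : f r * S.act r (g (r⁻¹ * s)) = 0 := by
  by_cases hr : r ∈ tsupport f
  · have hs := h.resolve_left (not_not.2 hr)
    have : r⁻¹ * s ∉ tsupport g := fun hg => hs ⟨r, hr, _, hg, by simp⟩
    rw [image_eq_zero_of_notMem_tsupport this, map_zero, mul_zero]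
  · rw [image_eq_zero_of_notMem_tsupport hr, zero_mul]

theorem integrable_convIntegrand (f g : C_c(G, A)) (s : G) :
    Integrable (fun r => f r * S.act r (g (r⁻¹ * s))) μ :=
  ((continuous_convIntegrand S f g).comp
    (continuous_const.prodMk continuous_id)).integrable_of_hasCompactSupport
    (HasCompactSupport.intro f.hasCompactSupport fun _ hr =>
      convIntegrand_eq_zero S f g (Or.inl hr))

/-- The twisted convolution `(f * g)(s) = ∫ f(r) α_r(g(r⁻¹ s)) dr` on `C_c(G, A)`. -/
def twistedConv (f g : C_c(G, A)) : C_c(G, A) where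
  toFun s := ∫ r, f r * S.act r (g (r⁻¹ * s)) ∂μ
  continuous_toFun := by
    rw [← continuousOn_univ]
    exact continuousOn_integral_of_compact_support (k := tsupport f) f.hasCompactSupport
      (continuous_convIntegrand S f g).continuousOn
      fun s r _ hr => convIntegrand_eq_zero S f g (Or.inl hr)
  hasCompactSupport' :=
    HasCompactSupport.intro (f.hasCompactSupport.isCompact.mul g.hasCompactSupport.isCompact)
      fun s hs => by
        simp only [convIntegrand_eq_zero S f g (Or.inr hs), integral_zero]

theorem twistedConv_apply (f g : C_c(G, A)) (s : G) :
    twistedConv μ S f g s = ∫ r, f r * S.act r (g (r⁻¹ * s)) ∂μ := rfl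

/-- The twisted convolution as a bilinear map. -/
def twistedConvₗ : C_c(G, A) →ₗ[ℝ] C_c(G, A) →ₗ[ℝ] C_c(G, A) :=
  LinearMap.mk₂ ℝ (twistedConv μ S)
    (fun f₁ f₂ g => by
      ext s
      simp only [twistedConv_apply, CompactlySupportedContinuousMap.add_apply, add_mul]
      exact integral_add (integrable_convIntegrand μ S f₁ g s)
        (integrable_convIntegrand μ S f₂ g s))
    (fun c f g => by
      ext s
      simp only [twistedConv_apply, CompactlySupportedContinuousMap.smul_apply, smul_mul_assoc]
      exact integral_smul c _)
    (fun f g₁ g₂ => by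
      ext s
      simp only [twistedConv_apply, CompactlySupportedContinuousMap.add_apply, map_add, mul_add]
      exact integral_add (integrable_convIntegrand μ S f g₁ s)
        (integrable_convIntegrand μ S f g₂ s))
    (fun c f g => by
      ext s
      simp only [twistedConv_apply, CompactlySupportedContinuousMap.smul_apply, map_smul,
        mul_smul_comm]
      exact integral_smul c _)

/-! ### Covariant representations and crossed products -/

/-- A continuous covariant representation `(π, U)` of `(A, G, α)` on `X`: `π` is a bounded algebra
representation, `U` a strongly continuous group representation (by invertible operators, since `G`
is a group), and `π(α_s(a)) = U_s π(a) U_s⁻¹`. -/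
structure CovRep (S : PreorderedSystem A G) (X : Type*) [NormedAddCommGroup X]
    [NormedSpace ℝ X] where
  alg : A →L[ℝ] X →L[ℝ] X
  alg_mul : ∀ a b, alg (a * b) = alg a * alg b
  grp : G →* (X →L[ℝ] X)
  continuous_grp : ∀ x, Continuous fun s => grp s x
  covariant : ∀ s a, alg (S.act s a) = grp s * alg a * grp s⁻¹

variable {S}

/-- The algebra representation of `(π, U)` is non-degenerate. -/
def CovRep.Nondegenerate {X : Type*} [NormedAddCommGroup X] [NormedSpace ℝ X] (ρ : CovRep S X) :
    Prop :=
  Dense (Submodule.span ℝ {y : X | ∃ a x, y = ρ.alg a x} : Set X)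

/-- The natural operator cone `B(X)₊ = {T | T X₊ ⊆ X₊}`. -/
def operatorCone {X : Type*} [NormedAddCommGroup X] [NormedSpace ℝ X] (C : PointedCone ℝ X) :
    PointedCone ℝ (X →L[ℝ] X) where
  carrier := {T | ∀ x ∈ C, T x ∈ C}
  add_mem' hT hT' x hx := C.add_mem (hT x hx) (hT' x hx)
  zero_mem' _ _ := C.zero_mem
  smul_mem' c _ hT x hx := C.smul_mem' c (hT x hx)

/-- The covariant representation `(π, U)` on the pre-ordered space `(X, C)` is positive. -/
def CovRep.Positive {X : Type*} [NormedAddCommGroup X] [NormedSpace ℝ X] (ρ : CovRep S X)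
    (C : PointedCone ℝ X) : Prop :=
  (∀ a ∈ S.cone, ρ.alg a ∈ operatorCone C) ∧ ∀ s, ρ.grp s ∈ operatorCone C

section Integrated

variable {X : Type*} [NormedAddCommGroup X] [NormedSpace ℝ X] [CompleteSpace X] (ρ : CovRep S X)

theorem CovRep.continuous_grp_uncurry : Continuous fun q : G × X => ρ.grp q.1 q.2 :=
  continuous_uncurry_of_strong ρ.continuous_grp

theorem CovRep.continuous_alg_uncurry : Continuous fun q : A × X => ρ.alg q.1 q.2 :=
  (ρ.alg.continuous.comp continuous_fst).clm_apply continuous_snd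

theorem CovRep.grp_grp (s t : G) (x : X) : ρ.grp s (ρ.grp t x) = ρ.grp (s * t) x := by
  rw [map_mul]; rfl

theorem CovRep.continuous_integrand (f : C_c(G, A)) (x : X) :
    Continuous fun r => ρ.alg (f r) (ρ.grp r x) :=
  ρ.continuous_alg_uncurry.comp (f.continuous.prodMk (ρ.continuous_grp x))

theorem CovRep.integrable_integrand (f : C_c(G, A)) (x : X) :
    Integrable (fun r => ρ.alg (f r) (ρ.grp r x)) μ :=
  (ρ.continuous_integrand f x).integrable_of_hasCompactSupport
    (HasCompactSupport.intro f.hasCompactSupport fun r hr => by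
      rw [image_eq_zero_of_notMem_tsupport hr, map_zero, zero_apply])

theorem CovRep.norm_integral_le (f : C_c(G, A)) {C D : ℝ} (hC0 : 0 ≤ C) (hC : ‖ρ.alg‖ ≤ C)
    (hD : ∀ s ∈ tsupport f, ‖ρ.grp s‖ ≤ D) (x : X) :
    ‖∫ r, ρ.alg (f r) (ρ.grp r x) ∂μ‖ ≤ C * D * (∫ r, ‖f r‖ ∂μ) * ‖x‖ := by
  have hi := integrable_norm_cc μ f
  calc ‖∫ r, ρ.alg (f r) (ρ.grp r x) ∂μ‖ ≤ ∫ r, C * D * ‖x‖ * ‖f r‖ ∂μ := by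
        refine norm_integral_le_of_norm_le (hi.const_mul _) (Eventually.of_forall fun r => ?_)
        by_cases hr : r ∈ tsupport f
        · have h1 : ‖ρ.alg (f r) (ρ.grp r x)‖ ≤ C * ‖f r‖ * (D * ‖x‖) :=
            ((ρ.alg (f r)).le_opNorm _).trans (mul_le_mul (ρ.alg.le_of_opNorm_le hC _)
              ((ρ.grp r).le_of_opNorm_le (hD r hr) x) (norm_nonneg _)
              (mul_nonneg hC0 (norm_nonneg _)))
          linarith
        · simp [image_eq_zero_of_notMem_tsupport hr]
    _ = _ := by rw [integral_const_mul]; ring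

/-- The integrated form `π ⋊ U : C_c(G, A) → B(X)`,
`(π ⋊ U)(f) x = ∫ π(f(r)) U_r x dr`. -/
def CovRep.integrated : C_c(G, A) →ₗ[ℝ] (X →L[ℝ] X) where
  toFun f := LinearMap.mkContinuousOfExistsBound
    { toFun := fun x => ∫ r, ρ.alg (f r) (ρ.grp r x) ∂μ
      map_add' := fun x y => by
        simp only [map_add]
        exact integral_add (ρ.integrable_integrand μ f x) (ρ.integrable_integrand μ f y)
      map_smul' := fun c x => by
        simp only [map_smul]
        exact integral_smul c _ }
    (by
      obtain ⟨D, -, hD⟩ := bddOn_compact_of_strong ρ.continuous_grp f.hasCompactSupport.isCompact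
      exact ⟨_, ρ.norm_integral_le μ f (norm_nonneg ρ.alg) le_rfl hD⟩)
  map_add' f g := by
    ext x
    change ∫ r, ρ.alg ((f + g) r) (ρ.grp r x) ∂μ = _
    simp only [CompactlySupportedContinuousMap.add_apply, map_add, add_apply]
    exact integral_add (ρ.integrable_integrand μ f x) (ρ.integrable_integrand μ g x)
  map_smul' c f := by
    ext x
    change ∫ r, ρ.alg ((c • f) r) (ρ.grp r x) ∂μ = _
    simp only [CompactlySupportedContinuousMap.smul_apply, map_smul, smul_apply]
    exact integral_smul c _

theorem CovRep.integrated_apply (f : C_c(G, A)) (x : X) :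
    ρ.integrated μ f x = ∫ r, ρ.alg (f r) (ρ.grp r x) ∂μ := rfl

theorem CovRep.norm_integrated_le (f : C_c(G, A)) {C D : ℝ} (hC0 : 0 ≤ C) (hC : ‖ρ.alg‖ ≤ C)
    (hD0 : 0 ≤ D) (hD : ∀ s ∈ tsupport f, ‖ρ.grp s‖ ≤ D) :
    ‖ρ.integrated μ f‖ ≤ C * D * ∫ r, ‖f r‖ ∂μ :=
  (ρ.integrated μ f).opNorm_le_bound
    (mul_nonneg (mul_nonneg hC0 hD0) (integral_nonneg fun _ => norm_nonneg _))
    (ρ.norm_integral_le μ f hC0 hC hD)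

/-- The integrated form is an algebra homomorphism for the twisted convolution. -/
theorem CovRep.integrated_conv (f g : C_c(G, A)) :
    ρ.integrated μ (twistedConv μ S f g) = ρ.integrated μ f * ρ.integrated μ g := by
  ext x
  change _ = ρ.integrated μ f (ρ.integrated μ g x)
  have hkey : ∀ s r, ρ.alg (f r * S.act r (g (r⁻¹ * s))) (ρ.grp s x) =
      ρ.alg (f r) (ρ.grp r (ρ.alg (g (r⁻¹ * s)) (ρ.grp (r⁻¹ * s) x))) := by
    intro s r
    rw [ρ.alg_mul, ρ.covariant]
    change ρ.alg (f r) (ρ.grp r (ρ.alg _ (ρ.grp r⁻¹ (ρ.grp s x)))) = _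
    rw [ρ.grp_grp]
  have hcont : Continuous (Function.uncurry fun s r =>
      ρ.alg (f r * S.act r (g (r⁻¹ * s))) (ρ.grp s x)) :=
    ρ.continuous_alg_uncurry.comp ((continuous_convIntegrand S f g).prodMk
      ((ρ.continuous_grp x).comp continuous_fst))
  have hsupp : HasCompactSupport (Function.uncurry fun s r =>
      ρ.alg (f r * S.act r (g (r⁻¹ * s))) (ρ.grp s x)) := by
    refine HasCompactSupport.intro ((f.hasCompactSupport.isCompact.mul
      g.hasCompactSupport.isCompact).prod f.hasCompactSupport.isCompact) ?_
    rintro ⟨s, r⟩ h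
    have h' : r ∉ tsupport f ∨ s ∉ tsupport f * tsupport g := by
      by_contra! h''
      exact h ⟨h''.2, h''.1⟩
    simp only [Function.uncurry_apply_pair]
    rw [convIntegrand_eq_zero S f g h', map_zero, zero_apply]
  calc ρ.integrated μ (twistedConv μ S f g) x
      = ∫ s, ∫ r, ρ.alg (f r * S.act r (g (r⁻¹ * s))) (ρ.grp s x) ∂μ ∂μ := by
        rw [CovRep.integrated_apply]
        refine integral_congr_ae (Eventually.of_forall fun s => ?_)
        exact ((ContinuousLinearMap.apply ℝ X (ρ.grp s x)).comp ρ.alg).integral_comp_comm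
          (integrable_convIntegrand μ S f g s) |>.symm
    _ = ∫ r, ∫ s, ρ.alg (f r * S.act r (g (r⁻¹ * s))) (ρ.grp s x) ∂μ ∂μ :=
        integral_integral_swap_of_hasCompactSupport hcont hsupp
    _ = ρ.integrated μ f (ρ.integrated μ g x) := by
        rw [CovRep.integrated_apply]
        refine integral_congr_ae (Eventually.of_forall fun r => ?_)
        simp only [hkey]
        rw [integral_mul_left_eq_self
          (fun s => ρ.alg (f r) (ρ.grp r (ρ.alg (g s) (ρ.grp s x)))) r⁻¹]
        exact ((ρ.alg (f r)).comp (ρ.grp r)).integral_comp_comm (ρ.integrable_integrand μ g x)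

end Integrated

/-- A continuous covariant representation of `(A, G, α)` on some Banach space. -/
structure BanachCovRep (S : PreorderedSystem A G) where
  X : Type*
  [normed : NormedAddCommGroup X]
  [space : NormedSpace ℝ X]
  [complete : CompleteSpace X]
  rep : CovRep S X

attribute [instance] BanachCovRep.normed BanachCovRep.space BanachCovRep.complete

/-- `R` is a uniformly bounded class of continuous covariant representations on Banach spaces. -/
def UniformlyBoundedClass (R : Set (BanachCovRep S)) : Prop :=
  ∃ (C : ℝ) (ν : G → ℝ), 0 ≤ C ∧ (∀ r, 0 ≤ ν r) ∧ (∀ K, IsCompact K → BddAbove (ν '' K)) ∧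
    ∀ ρ ∈ R, ‖ρ.rep.alg‖ ≤ C ∧ ∀ r, ‖ρ.rep.grp r‖ ≤ ν r

theorem UniformlyBoundedClass.bddAbove {R : Set (BanachCovRep S)} (hR : UniformlyBoundedClass R)
    (f : C_c(G, A)) : BddAbove (range fun ρ : R => ‖ρ.1.rep.integrated μ f‖) := by
  obtain ⟨C, ν, hC0, hν0, hν, h⟩ := hR
  obtain ⟨D, hD⟩ := hν _ f.hasCompactSupport.isCompact
  refine ⟨C * max D 0 * ∫ r, ‖f r‖ ∂μ, ?_⟩
  rintro _ ⟨ρ, rfl⟩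
  exact ρ.1.rep.norm_integrated_le μ f hC0 (h _ ρ.2).1 (le_max_right _ _) fun s hs =>
    ((h _ ρ.2).2 s).trans ((hD (mem_image_of_mem _ hs)).trans (le_max_left _ _))

/-- The seminorm `σ^R(f) = sup_{(π, U) ∈ R} ‖(π ⋊ U)(f)‖` on `C_c(G, A)`. -/
def crossedSeminorm (R : Set (BanachCovRep S)) (hR : UniformlyBoundedClass R) :
    Seminorm ℝ C_c(G, A) :=
  Seminorm.of (fun f => ⨆ ρ : R, ‖ρ.1.rep.integrated μ f‖)
    (fun f g => Real.iSup_le (fun ρ => by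
        rw [map_add]
        exact (norm_add_le _ _).trans (add_le_add (le_ciSup (hR.bddAbove μ f) ρ)
          (le_ciSup (hR.bddAbove μ g) ρ)))
      (add_nonneg (Real.iSup_nonneg fun _ => norm_nonneg _)
        (Real.iSup_nonneg fun _ => norm_nonneg _)))
    (fun c f => by
      rw [Real.mul_iSup_of_nonneg (norm_nonneg c)]
      simp only [map_smul, norm_smul])

theorem crossedSeminorm_apply (R : Set (BanachCovRep S)) (hR : UniformlyBoundedClass R)
    (f : C_c(G, A)) : crossedSeminorm μ R hR f = ⨆ ρ : R, ‖ρ.1.rep.integrated μ f‖ := rfl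

/-- The seminorm `σ^R` is submultiplicative. -/
theorem crossedSeminorm_conv_le (R : Set (BanachCovRep S)) (hR : UniformlyBoundedClass R)
    (f g : C_c(G, A)) : crossedSeminorm μ R hR (twistedConvₗ μ S f g) ≤
      crossedSeminorm μ R hR f * crossedSeminorm μ R hR g := by
  refine Real.iSup_le (fun ρ => ?_) (mul_nonneg (apply_nonneg _ f) (apply_nonneg _ g))
  change ‖ρ.1.rep.integrated μ (twistedConv μ S f g)‖ ≤ _
  rw [CovRep.integrated_conv]
  exact (norm_mul_le _ _).trans (mul_le_mul (le_ciSup (hR.bddAbove μ f) ρ)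
    (le_ciSup (hR.bddAbove μ g) ρ) (norm_nonneg _) (apply_nonneg _ f))

/-- The crossed product `(A ⋊_α G)^R`, as a Banach space: the completion of
`C_c(G, A) / ker σ^R`. -/
abbrev CrossedProduct (R : Set (BanachCovRep S)) (hR : UniformlyBoundedClass R) : Type _ :=
  Compl (crossedSeminorm μ R hR)

/-- The quotient map `q^R : C_c(G, A) → (A ⋊_α G)^R`. -/
def toCrossed (R : Set (BanachCovRep S)) (hR : UniformlyBoundedClass R) :
    C_c(G, A) →ₗ[ℝ] CrossedProduct μ R hR := toCompl (crossedSeminorm μ R hR)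

/-- The multiplication of `(A ⋊_α G)^R`: the continuous extension of the twisted convolution. -/
def crossedMul (R : Set (BanachCovRep S)) (hR : UniformlyBoundedClass R) :
    CrossedProduct μ R hR →L[ℝ] CrossedProduct μ R hR →L[ℝ] CrossedProduct μ R hR :=
  mulCompl (crossedSeminorm μ R hR) (twistedConvₗ μ S) ⟨1, zero_le_one, fun f g => by
    simpa using crossedSeminorm_conv_le μ R hR f g⟩

/-- The cone of `(A ⋊_α G)^R`: the closure of the image of `C_c(G, A₊)`. -/
def crossedCone (R : Set (BanachCovRep S)) (hR : UniformlyBoundedClass R) :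
    PointedCone ℝ (CrossedProduct μ R hR) :=
  complCone (crossedSeminorm μ R hR) (ccCone S.cone)

end Crossed

/-! ### Induced covariant representations on `L¹(G, X, ω)` and generalized Beurling algebras -/

section Induced

variable {A G : Type*} [NonUnitalNormedRing A] [NormedSpace ℝ A] [IsScalarTower ℝ A A]
  [SMulCommClass ℝ A A] [CompleteSpace A] [Group G] [TopologicalSpace G] [IsTopologicalGroup G]
  [LocallyCompactSpace G] [T2Space G] [MeasurableSpace G] [BorelSpace G]
  (μ : Measure G) [μ.IsHaarMeasure] [μ.Regular] (ω : Weight G) (S : PreorderedSystem A G)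

section

variable {X : Type*} [NormedAddCommGroup X] [NormedSpace ℝ X] (π : A →L[ℝ] X →L[ℝ] X)

/-- The operator `[π̃(a) h](s) = π(α_s⁻¹(a)) h(s)` on `C_c(G, X)`. -/
def inducedAlgCc (a : A) : C_c(G, X) →ₗ[ℝ] C_c(G, X) where
  toFun h :=
    { toFun := fun s => π (S.act s⁻¹ a) (h s)
      continuous_toFun :=
        (π.continuous.comp ((S.continuous_act a).comp continuous_inv)).clm_apply h.continuous
      hasCompactSupport' := HasCompactSupport.intro h.hasCompactSupport fun s hs => by
        rw [image_eq_zero_of_notMem_tsupport hs, map_zero] }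
  map_add' h k := by
    ext s
    exact map_add (π (S.act s⁻¹ a)) (h s) (k s)
  map_smul' c h := by
    ext s
    exact map_smul (π (S.act s⁻¹ a)) c (h s)

theorem inducedAlgCc_apply (a : A) (h : C_c(G, X)) (s : G) :
    inducedAlgCc S π a h s = π (S.act s⁻¹ a) (h s) := rfl

/-- The left translation `(Λ_r h)(s) = h(r⁻¹ s)` on `C_c(G, X)`. -/
def translationCc (r : G) : C_c(G, X) →ₗ[ℝ] C_c(G, X) where
  toFun h :=
    { toFun := fun s => h (r⁻¹ * s)
      continuous_toFun := h.continuous.comp (continuous_const_mul r⁻¹)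
      hasCompactSupport' := h.hasCompactSupport.comp_homeomorph (Homeomorph.mulLeft r⁻¹) }
  map_add' _ _ := rfl
  map_smul' _ _ := rfl

theorem translationCc_apply (r : G) (h : C_c(G, X)) (s : G) :
    translationCc r h s = h (r⁻¹ * s) := rfl

theorem weightedNorm_translation_le (r : G) (h : C_c(G, X)) :
    weightedNorm μ ω X (translationCc r h) ≤ ω r * weightedNorm μ ω X h := by
  have h1 : weightedNorm μ ω X (translationCc r h) = ∫ s, ‖h s‖ * ω (r * s) ∂μ := by
    rw [weightedNorm_apply, ← integral_mul_left_eq_self (fun s => ‖h s‖ * ω (r * s)) r⁻¹]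
    simp only [translationCc_apply, mul_inv_cancel_left]
  rw [h1, weightedNorm_apply, ← integral_const_mul]
  refine integral_mono_of_nonneg (Eventually.of_forall fun s =>
    mul_nonneg (norm_nonneg _) (ω.nonneg' _)) ((ω.integrable μ h).const_mul _)
    (Eventually.of_forall fun s => ?_)
  calc ‖h s‖ * ω (r * s) ≤ ‖h s‖ * (ω r * ω s) :=
        mul_le_mul_of_nonneg_left (ω.mul_le' r s) (norm_nonneg _)
    _ = _ := by ring

theorem weightedNorm_inducedAlg_le {C : ℝ} (hC : ∀ s, ‖S.act s‖ ≤ C) (a : A) (h : C_c(G, X)) :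
    weightedNorm μ ω X (inducedAlgCc S π a h) ≤ ‖π‖ * C * ‖a‖ * weightedNorm μ ω X h := by
  rw [weightedNorm_apply, weightedNorm_apply, ← integral_const_mul]
  refine integral_mono (ω.integrable μ _) ((ω.integrable μ h).const_mul _) fun s => ?_
  have h1 : ‖π (S.act s⁻¹ a) (h s)‖ ≤ ‖π‖ * (C * ‖a‖) * ‖h s‖ := by
    refine (π (S.act s⁻¹ a)).le_of_opNorm_le ?_ _
    exact (π.le_opNorm _).trans (mul_le_mul_of_nonneg_left
      ((S.act s⁻¹).le_of_opNorm_le (hC _) a) (norm_nonneg _))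
  calc ‖inducedAlgCc S π a h s‖ * ω s ≤ ‖π‖ * (C * ‖a‖) * ‖h s‖ * ω s :=
        mul_le_mul_of_nonneg_right h1 (ω.nonneg' s)
    _ = _ := by ring

theorem continuous_translation (h : C_c(G, X)) :
    Continuous fun r => toBeurling μ ω (translationCc r h) := by
  rw [continuous_iff_continuousAt]
  intro r₀
  obtain ⟨K, hK, hKn⟩ := exists_compact_mem_nhds r₀
  have h1 : ContinuousOn (fun r => ∫ s, ‖h (r⁻¹ * s) - h (r₀⁻¹ * s)‖ ∂(ω.measure μ)) K := by
    refine continuousOn_integral_of_compact_support (k := K * tsupport h)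
      (hK.mul h.hasCompactSupport.isCompact) (Continuous.continuousOn ?_) ?_
    · have := h.continuous
      simp only [Function.uncurry_def]
      fun_prop
    · intro r s hr hs
      have h0 : ∀ t ∈ K, h (t⁻¹ * s) = 0 := fun t ht =>
        image_eq_zero_of_notMem_tsupport fun hts => hs ⟨t, ht, _, hts, by simp⟩
      rw [h0 r hr, h0 r₀ (mem_of_mem_nhds hKn), sub_zero, norm_zero]
  have h2 := (h1.continuousAt hKn).tendsto
  simp only [sub_self, norm_zero, integral_zero] at h2
  rw [ContinuousAt, tendsto_iff_norm_sub_tendsto_zero]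
  refine h2.congr fun r => ?_
  rw [← map_sub, toBeurling, norm_toCompl, weightedNorm_apply']
  rfl

/-- For a bounded representation `π` of `A` on `X` and a uniformly bounded action, the covariant
representation `(π̃, Λ)` of `(A, G, α)` on `L¹(G, X, ω)`, given on `C_c(G, X)` by
`[π̃(a) h](s) = π(α_s⁻¹(a)) h(s)` and `(Λ_r h)(s) = h(r⁻¹ s)`. -/
def inducedRep (hS : S.UniformlyBounded) (hπ : ∀ a b, π (a * b) = π a * π b) :
    CovRep S (BeurlingSpace μ ω X) :=
  have hA : ∀ a, ∃ C, ∀ h, weightedNorm μ ω X (inducedAlgCc S π a h) ≤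
      C * weightedNorm μ ω X h := fun a =>
    let ⟨_, hC⟩ := hS
    ⟨_, weightedNorm_inducedAlg_le μ ω S π hC a⟩
  have hT : ∀ r, ∃ C, ∀ h, weightedNorm μ ω X (translationCc r h) ≤
      C * weightedNorm μ ω X h := fun r => ⟨_, weightedNorm_translation_le μ ω r⟩
  { alg := LinearMap.mkContinuousOfExistsBound
      { toFun := fun a => mapCompl (weightedNorm μ ω X) (inducedAlgCc S π a)
        map_add' := fun a b => by
          refine ext_compl _ fun h => ?_
          rw [add_apply, mapCompl_toCompl _ _ (hA _), mapCompl_toCompl _ _ (hA _),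
            mapCompl_toCompl _ _ (hA _), ← map_add]
          congr 1
          ext s
          simp [inducedAlgCc_apply]
        map_smul' := fun c a => by
          refine ext_compl _ fun h => ?_
          rw [smul_apply, mapCompl_toCompl _ _ (hA _), mapCompl_toCompl _ _ (hA _), ← map_smul]
          congr 1
          ext s
          simp [inducedAlgCc_apply] }
      (by
        obtain ⟨C, hC⟩ := hS
        have hC0 : 0 ≤ C := (norm_nonneg _).trans (hC 1)
        exact ⟨‖π‖ * C, fun a => norm_mapCompl_le _ _ (by positivity)
          (weightedNorm_inducedAlg_le μ ω S π hC a)⟩)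
    alg_mul := fun a b => by
      refine ext_compl _ fun h => ?_
      change mapCompl _ _ _ = mapCompl _ _ (mapCompl _ _ _)
      rw [mapCompl_toCompl _ _ (hA _), mapCompl_toCompl _ _ (hA _), mapCompl_toCompl _ _ (hA _)]
      congr 1
      ext s
      simp only [inducedAlgCc_apply, S.act_mul, hπ]
      rfl
    grp :=
      { toFun := fun r => mapCompl (weightedNorm μ ω X) (translationCc r)
        map_one' := by
          refine ext_compl _ fun h => ?_
          rw [mapCompl_toCompl _ _ (hT _)]
          change _ = toCompl _ h
          congr 1
          ext s
          simp [translationCc_apply]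
        map_mul' := fun r t => by
          refine ext_compl _ fun h => ?_
          change _ = mapCompl _ _ (mapCompl _ _ _)
          rw [mapCompl_toCompl _ _ (hT _), mapCompl_toCompl _ _ (hT _), mapCompl_toCompl _ _ (hT _)]
          congr 1
          ext s
          simp [translationCc_apply, mul_assoc] }
    continuous_grp := fun x => by
      rw [continuous_iff_continuousAt]
      intro r₀
      obtain ⟨K, hK, hKn⟩ := exists_compact_mem_nhds r₀
      obtain ⟨C, hC0, hC⟩ := ω.bddOn_compact μ hK
      refine ContinuousOn.continuousAt (s := K) ?_ hKn
      refine continuousOn_of_uniform_approx_of_continuousOn fun u hu => ?_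
      obtain ⟨ε, hε, hεu⟩ := Metric.mem_uniformity_dist.1 hu
      obtain ⟨h, hh⟩ := (denseRange_toCompl (weightedNorm μ ω X)).exists_dist_lt x
        (show 0 < ε / (C + 1) by positivity)
      refine ⟨fun r => toBeurling μ ω (translationCc r h),
        (continuous_translation μ ω h).continuousOn, fun r hr => hεu ?_⟩
      change dist (mapCompl _ (translationCc r) x) (toCompl _ (translationCc r h)) < ε
      rw [← mapCompl_toCompl _ _ (hT r), dist_eq_norm, ← map_sub]
      have hn : ‖mapCompl (weightedNorm μ ω X) (translationCc r)‖ ≤ C :=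
        norm_mapCompl_le _ _ hC0 fun h => (weightedNorm_translation_le μ ω r h).trans
          (mul_le_mul_of_nonneg_right (hC r hr) (apply_nonneg _ h))
      rw [dist_eq_norm] at hh
      calc _ ≤ C * ‖x - toCompl (weightedNorm μ ω X) h‖ := ContinuousLinearMap.le_of_opNorm_le _ hn _
        _ ≤ C * (ε / (C + 1)) := mul_le_mul_of_nonneg_left hh.le hC0
        _ < ε := by
          rw [mul_div_assoc', div_lt_iff₀ (by positivity)]
          nlinarith
    covariant := fun t a => by
      refine ext_compl _ fun h => ?_
      change mapCompl _ _ _ = mapCompl _ _ (mapCompl _ _ (mapCompl _ _ _))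
      rw [mapCompl_toCompl _ _ (hA _), mapCompl_toCompl _ _ (hT _), mapCompl_toCompl _ _ (hA _),
        mapCompl_toCompl _ _ (hT _)]
      congr 1
      ext s
      simp only [translationCc_apply, inducedAlgCc_apply, S.act_act, mul_inv_rev, inv_inv,
        mul_inv_cancel_left] }

theorem inducedRep_alg_apply (hS : S.UniformlyBounded) (hπ : ∀ a b, π (a * b) = π a * π b)
    (a : A) (h : C_c(G, X)) : (inducedRep μ ω S π hS hπ).alg a (toBeurling μ ω h) =
      toBeurling μ ω (inducedAlgCc S π a h) := by
  obtain ⟨C, hC⟩ := hS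
  exact mapCompl_toCompl _ _ ⟨_, weightedNorm_inducedAlg_le μ ω S π hC a⟩ h

theorem inducedRep_grp_apply (hS : S.UniformlyBounded) (hπ : ∀ a b, π (a * b) = π a * π b)
    (r : G) (h : C_c(G, X)) : (inducedRep μ ω S π hS hπ).grp r (toBeurling μ ω h) =
      toBeurling μ ω (translationCc r h) :=
  mapCompl_toCompl _ _ ⟨_, weightedNorm_translation_le μ ω r⟩ h

end

/-- The covariant representation `(λ̃, Λ)` of `(A, G, α)` on `L¹(G, A, ω)`, induced from the left
regular representation `λ(a) b = a b` of `A`. -/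
def regularRep (hS : S.UniformlyBounded) : CovRep S (BeurlingSpace μ ω A) :=
  inducedRep μ ω S (ContinuousLinearMap.mul ℝ A) hS fun a b => by
    ext c
    exact mul_assoc a b c

/-- The class `R = {(λ̃, Λ)}`. -/
def regularClass (hS : S.UniformlyBounded) : Set (BanachCovRep S) :=
  {⟨BeurlingSpace μ ω A, regularRep μ ω S hS⟩}

theorem norm_regularRep_grp_le (hS : S.UniformlyBounded) (r : G) :
    ‖(regularRep μ ω S hS).grp r‖ ≤ ω r :=
  norm_mapCompl_le _ _ (ω.nonneg' r) (weightedNorm_translation_le μ ω r)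

theorem uniformlyBounded_regularClass (hS : S.UniformlyBounded) :
    UniformlyBoundedClass (regularClass μ ω S hS) := by
  refine ⟨‖(regularRep μ ω S hS).alg‖, ω, norm_nonneg (regularRep μ ω S hS).alg, ω.nonneg', fun K hK => ?_, ?_⟩
  · obtain ⟨C, -, hC⟩ := ω.bddOn_compact μ hK
    exact ⟨C, by rintro _ ⟨s, hs, rfl⟩; exact hC s hs⟩
  · rintro _ rfl
    exact ⟨le_rfl, norm_regularRep_grp_le μ ω S hS⟩

/-- The twisted convolution is bounded for the norm `‖·‖_{1,ω}`. -/
theorem weightedNorm_conv_le {C : ℝ} (hC : ∀ s, ‖S.act s‖ ≤ C) (f g : C_c(G, A)) :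
    weightedNorm μ ω A (twistedConvₗ μ S f g) ≤
      C * weightedNorm μ ω A f * weightedNorm μ ω A g := by
  have hC0 : 0 ≤ C := (norm_nonneg _).trans (hC 1)
  let k : G → G → ℝ := fun s r => ‖f r‖ * ‖g (r⁻¹ * s)‖
  have hk0 : ∀ {s r}, (r ∉ tsupport f ∨ s ∉ tsupport f * tsupport g) → k s r = 0 := by
    intro s r h
    by_cases hr : r ∈ tsupport f
    · have hs := h.resolve_left (not_not.2 hr)
      have : r⁻¹ * s ∉ tsupport g := fun hg => hs ⟨r, hr, _, hg, by simp⟩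
      simp [k, image_eq_zero_of_notMem_tsupport this]
    · simp [k, image_eq_zero_of_notMem_tsupport hr]
  have hkc : Continuous (Function.uncurry k) := by
    have := f.continuous
    have := g.continuous
    simp only [Function.uncurry_def, k]
    fun_prop
  have hks : HasCompactSupport (Function.uncurry k) := by
    refine HasCompactSupport.intro ((f.hasCompactSupport.isCompact.mul
      g.hasCompactSupport.isCompact).prod f.hasCompactSupport.isCompact) ?_
    rintro ⟨s, r⟩ h
    refine hk0 ?_
    by_contra! h''
    exact h ⟨h''.2, h''.1⟩
  have hki : ∀ s, Integrable (k s) μ := fun s =>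
    (hkc.comp (continuous_const.prodMk continuous_id)).integrable_of_hasCompactSupport
      (HasCompactSupport.intro f.hasCompactSupport fun r hr => hk0 (Or.inl hr))
  have hIc : Continuous fun s => ∫ r, k s r ∂μ := by
    rw [← continuousOn_univ]
    exact continuousOn_integral_of_compact_support f.hasCompactSupport hkc.continuousOn
      fun s r _ hr => hk0 (Or.inl hr)
  have hIi : Integrable (fun s => ∫ r, k s r ∂μ) (ω.measure μ) :=
    hIc.integrable_of_hasCompactSupport (HasCompactSupport.intro
      (f.hasCompactSupport.isCompact.mul g.hasCompactSupport.isCompact) fun s hs => by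
        simp only [hk0 (Or.inr hs), integral_zero])
  have hin : ∀ r, ∫ s, ‖g (r⁻¹ * s)‖ ∂(ω.measure μ) ≤ ω r * weightedNorm μ ω A g := by
    intro r
    rw [ω.integral_measure μ]
    exact weightedNorm_translation_le μ ω r g
  calc weightedNorm μ ω A (twistedConvₗ μ S f g)
      = ∫ s, ‖∫ r, f r * S.act r (g (r⁻¹ * s)) ∂μ‖ ∂(ω.measure μ) := weightedNorm_apply' μ ω _
    _ ≤ ∫ s, C * ∫ r, k s r ∂μ ∂(ω.measure μ) := by
        refine integral_mono_of_nonneg (Eventually.of_forall fun _ => norm_nonneg _)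
          (hIi.const_mul C) (Eventually.of_forall fun s => ?_)
        simp only [← integral_const_mul]
        refine norm_integral_le_of_norm_le ((hki s).const_mul C) (Eventually.of_forall fun r => ?_)
        calc ‖f r * S.act r (g (r⁻¹ * s))‖ ≤ ‖f r‖ * (C * ‖g (r⁻¹ * s)‖) :=
              (norm_mul_le _ _).trans (mul_le_mul_of_nonneg_left
                ((S.act r).le_of_opNorm_le (hC r) _) (norm_nonneg _))
          _ = _ := by simp only [k]; ring
    _ = C * ∫ r, ∫ s, k s r ∂(ω.measure μ) ∂μ := by
        rw [integral_const_mul, integral_integral_swap_of_hasCompactSupport hkc hks]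
    _ ≤ C * ∫ r, ‖f r‖ * ω r * weightedNorm μ ω A g ∂μ := by
        refine mul_le_mul_of_nonneg_left ?_ hC0
        refine integral_mono_of_nonneg (Eventually.of_forall fun r =>
          integral_nonneg fun s => mul_nonneg (norm_nonneg _) (norm_nonneg _))
          ((ω.integrable μ f).mul_const _) (Eventually.of_forall fun r => ?_)
        simp only [k, integral_const_mul, mul_assoc]
        exact mul_le_mul_of_nonneg_left (hin r) (norm_nonneg _)
    _ = _ := by rw [integral_mul_const, weightedNorm_apply μ ω f, mul_assoc]

/-- The multiplication of the generalized Beurling algebra `L¹(G, A, ω; α)`, i.e. of the space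
`L¹(G, A, ω)`: the continuous extension of the twisted convolution. -/
def beurlingMul (hS : S.UniformlyBounded) :
    BeurlingSpace μ ω A →L[ℝ] BeurlingSpace μ ω A →L[ℝ] BeurlingSpace μ ω A :=
  mulCompl (weightedNorm μ ω A) (twistedConvₗ μ S) (by
    obtain ⟨C, hC⟩ := hS
    exact ⟨C, (norm_nonneg _).trans (hC 1), weightedNorm_conv_le μ ω S hC⟩)

end Induced

/-! ### Approximate right identities -/

/-- `A` has an `M`-bounded approximate right identity consisting of elements of `P`: a net `(u_i)`
in `P` with `‖u_i‖ ≤ M` for all `i` and `a u_i → a` for all `a`. -/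
def HasApproxRightIdentity.{v, u} {A : Type u} [NonUnitalNormedRing A] (M : ℝ) (P : Set A) :
    Prop :=
  ∃ (ι : Type v) (_ : Preorder ι) (_ : IsDirectedOrder ι) (_ : Nonempty ι) (u : ι → A),
    (∀ i, u i ∈ P ∧ ‖u i‖ ≤ M) ∧ ∀ a, Tendsto (fun i => a * u i) atTop (𝓝 a)

end OrderedCrossedProduct

end

open OrderedCrossedProduct
universe u v w

/-! Everything rests on the claim that `‖(λ̃ ⋊ Λ)(f)‖` and `‖f‖_{1,ω}` are equivalent norms on
`C_c(G, A)`. Since R has a single element, `σ^R(f)` is the operator norm `‖(λ̃ ⋊ Λ)(f)‖`. Hence Ψ is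
isometric at once, and the equivalence makes the identity of `C_c(G, A)` extend to the isomorphism
Φ. Algebraic and order properties then pass to the completions by density and closedness of the
cones.

Let C bound all `‖α_s‖`. The upper bound `‖(λ̃ ⋊ Λ)(f)‖ ≤ C ‖f‖_{1,ω}` follows from `‖λ̃(a)‖ ≤ C
‖a‖` and `‖Λ_r‖ ≤ ω(r)` (`norm_integrated_regularRep_le`).

For the lower bound, let J be the twist `(J h)(s) = α_s⁻¹(h(s))`. Then `(λ̃ ⋊ Λ)(f) h = J(f * J⁻¹
h)` (`integrated_regularRep_toBeurling`). For an elementary tensor `h = z ⊗ u` this is `s ↦ α_s⁻¹(∫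
z(r⁻¹ s) f(r) dr) u`. If z is a normalized bump near e and u a suitable term of the approximate
right identity, the result is close to `J f` (`exists_integrated_tensorCc_approx`). As `‖z ⊗ u‖ ≤ M
B`, where M bounds u and B bounds ω near e, and as `J⁻¹` costs a factor C, this gives `‖f‖_{1,ω} ≤ C
M B ‖(λ̃ ⋊ Λ)(f)‖` (`weightedNorm_le_norm_integrated`). In the isometric case `C = M = 1` and B can
be taken arbitrarily close to 1.

The same approximation gives the rest. The vectors `J f` exhaust `C_c(G, A)`, whence non-degeneracy.
If u is positive, so is `z ⊗ u`; a positive operator in the range of Ψ sends it to a positive vector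
near `J y`, so `J y`, and with it y, is positive (`mem_beurlingCone_of_mem_operatorCone`). -/

noncomputable section

namespace OrderedCrossedProduct

/-! ### Closed cones: integration, completion, operators -/

section General

/-- A closed cone is stable under integration of functions with compact support. -/
theorem integral_mem_of_isClosed_cone {G X : Type*} [TopologicalSpace G] [R1Space G]
    [MeasurableSpace G] [BorelSpace G] [NormedAddCommGroup X] [NormedSpace ℝ X] [CompleteSpace X]
    (μ : Measure G) [IsFiniteMeasureOnCompacts μ] {C : PointedCone ℝ X}
    (hC : IsClosed (C : Set X)) {g : G → X} (hg : Integrable g μ) {K : Set G} (hK : IsCompact K)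
    (h0 : ∀ r ∉ K, g r = 0) (hmem : ∀ r, g r ∈ C) : ∫ r, g r ∂μ ∈ C := by
  wlog hKc : IsClosed K generalizing K
  · exact this hK.closure (fun r hr => h0 r fun h => hr (subset_closure h)) isClosed_closure
  rw [← setIntegral_eq_integral_of_forall_compl_eq_zero h0]
  rcases eq_or_ne (μ K) 0 with hK0 | hK0
  · rw [Measure.restrict_eq_zero.2 hK0, integral_zero_measure]
    exact C.zero_mem
  -- A closed convex set contains the average of g over K, and a cone also contains its multiple by
  -- `μ(K)`, which is the integral.
  have h := Convex.set_average_mem C.convex hC hK0 hK.measure_lt_top.ne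
    (Eventually.of_forall hmem) hg.integrableOn
  rw [setAverage_eq] at h
  have h' := C.smul_mem' ⟨μ.real K, measureReal_nonneg⟩ h
  have hK1 : μ.real K ≠ 0 := ENNReal.toReal_ne_zero.2 ⟨hK0, hK.measure_lt_top.ne⟩
  change μ.real K • ((μ.real K)⁻¹ • ∫ r in K, g r ∂μ) ∈ C at h'
  rwa [smul_inv_smul₀ hK1] at h'

theorem toCompl_mem_complCone {V : Type*} [AddCommGroup V] [Module ℝ V] (p : Seminorm ℝ V)
    {C : PointedCone ℝ V} {v : V} (hv : v ∈ C) : toCompl p v ∈ complCone p C :=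
  subset_closure ⟨v, hv, rfl⟩

theorem isClosed_complCone {V : Type*} [AddCommGroup V] [Module ℝ V] (p : Seminorm ℝ V)
    (C : PointedCone ℝ V) : IsClosed (complCone p C : Set (Compl p)) :=
  isClosed_closure

/-- A continuous map sends the cone of a completion into a closed set as soon as it does so for
the cone of the original space. -/
theorem complCone_induction {V Y : Type*} [AddCommGroup V] [Module ℝ V] [TopologicalSpace Y]
    (p : Seminorm ℝ V) {C : PointedCone ℝ V} {D : Set Y} (hD : IsClosed D) {T : Compl p → Y}
    (hT : Continuous T) (h : ∀ v ∈ C, T (toCompl p v) ∈ D) {x : Compl p}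
    (hx : x ∈ complCone p C) : T x ∈ D := by
  refine closure_minimal (t := T ⁻¹' D) ?_ (hD.preimage hT) hx
  rintro _ ⟨v, hv, rfl⟩
  exact h v hv

theorem isClosed_operatorCone {X : Type*} [NormedAddCommGroup X] [NormedSpace ℝ X]
    {C : PointedCone ℝ X} (hC : IsClosed (C : Set X)) :
    IsClosed (operatorCone C : Set (X →L[ℝ] X)) := by
  have : (operatorCone C : Set (X →L[ℝ] X)) = ⋂ x ∈ C, {T | T x ∈ C} := by
    ext T
    simp only [mem_iInter]
    rfl
  rw [this]
  exact isClosed_biInter fun x _ => hC.preimage (ContinuousLinearMap.apply ℝ X x).continuous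

end General

/-! ### Vector-valued integrals in `L¹(G, X, ω)` -/

section Beurling

variable {G : Type*} [Group G] [TopologicalSpace G] [IsTopologicalGroup G] [LocallyCompactSpace G]
  [T2Space G] [MeasurableSpace G] [BorelSpace G] (μ : Measure G) [μ.IsHaarMeasure] [μ.Regular]
  (ω : Weight G) {X : Type*} [NormedAddCommGroup X] [NormedSpace ℝ X]

theorem weightedNorm_le_of_bound {K : Set G} (hK : IsCompact K) (h : C_c(G, X))
    (h0 : ∀ s ∉ K, h s = 0) {ε : ℝ} (hε : ∀ s, ‖h s‖ ≤ ε) :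
    weightedNorm μ ω X h ≤ ε * (ω.measure μ).real K := by
  rw [weightedNorm_apply', ← setIntegral_eq_integral_of_forall_compl_eq_zero (s := K)
    fun s hs => by rw [h0 s hs, norm_zero]]
  refine (le_abs_self _).trans ?_
  rw [← Real.norm_eq_abs]
  exact norm_setIntegral_le_of_norm_le_const hK.measure_lt_top fun s _ => by
    simpa using hε s

/-- Multiplication by a cutoff function, from the bounded continuous functions to
`L¹(G, X, ω)`. -/
def cutoff {χ : C_c(G, ℝ)} (hχ : ∀ s, ‖χ s‖ ≤ 1) :
    BoundedContinuousFunction G X →L[ℝ] BeurlingSpace μ ω X :=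
  LinearMap.mkContinuous (toBeurling μ ω ∘ₗ
    { toFun := fun b =>
        { toFun := fun s => χ s • b s
          continuous_toFun := χ.continuous.smul b.continuous
          hasCompactSupport' := χ.hasCompactSupport.smul_right }
      map_add' := fun b c => by ext s; exact smul_add _ _ _
      map_smul' := fun t b => by ext s; exact smul_comm _ _ _ })
    ((ω.measure μ).real (tsupport χ)) fun b => by
      rw [LinearMap.comp_apply, toBeurling, norm_toCompl, mul_comm]
      refine weightedNorm_le_of_bound μ ω χ.hasCompactSupport.isCompact _ (fun s hs => ?_)
        fun s => ?_
      · change χ s • b s = 0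
        rw [image_eq_zero_of_notMem_tsupport hs, zero_smul]
      · change ‖χ s • b s‖ ≤ ‖b‖
        rw [norm_smul]
        exact (mul_le_of_le_one_left (norm_nonneg _) (hχ s)).trans (b.norm_coe_le_norm s)

theorem cutoff_eq {χ : C_c(G, ℝ)} (hχ : ∀ s, ‖χ s‖ ≤ 1) (b : BoundedContinuousFunction G X)
    (h : C_c(G, X)) (hb : ∀ s, χ s • b s = h s) : cutoff μ ω hχ b = toBeurling μ ω h := by
  change toBeurling μ ω _ = _
  congr 1
  ext s
  exact hb s

/-- Compactness of the common support L upgrades joint continuity to closeness uniform on L; off L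
all the functions vanish. -/
theorem continuous_toBoundedContinuousFunction {Y : Type*} [TopologicalSpace Y]
    {H : Y → C_c(G, X)} (hc : Continuous fun q : Y × G => H q.1 q.2)
    {L : Set G} (hL : IsCompact L) (h0 : ∀ r, ∀ s ∉ L, H r s = 0) :
    Continuous fun r => (H r).toBoundedContinuousFunction := by
  rw [continuous_iff_continuousAt]
  intro r₀
  rw [ContinuousAt, Metric.tendsto_nhds]
  intro ε hε
  have h1 : ∀ᶠ r in 𝓝 r₀, ∀ s ∈ L, ‖H r s - H r₀ s‖ < ε / 2 := by
    refine hL.eventually_forall_of_forall_eventually fun s _ => ?_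
    have h2 : Continuous fun q : Y × G => ‖H q.1 q.2 - H r₀ q.2‖ :=
      (hc.sub ((H r₀).continuous.comp continuous_snd)).norm
    refine h2.continuousAt.eventually_lt continuousAt_const ?_
    simpa using hε
  filter_upwards [h1] with r hr
  refine lt_of_le_of_lt ?_ (half_lt_self hε)
  refine (BoundedContinuousFunction.dist_le (half_pos hε).le).2 fun s => ?_
  change dist (H r s) (H r₀ s) ≤ _
  rw [dist_eq_norm]
  by_cases hs : s ∈ L
  · exact (hr s hs).le
  · rw [h0 r s hs, h0 r₀ s hs, sub_zero, norm_zero]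
    exact (half_pos hε).le

/-- Integrals of compactly supported continuous families in `L¹(G, X, ω)` are computed
pointwise. -/
theorem integral_toBeurling [CompleteSpace X] {H : G → C_c(G, X)}
    (hc : Continuous fun q : G × G => H q.1 q.2) {K L : Set G} (hK : IsCompact K)
    (hL : IsCompact L) (hK0 : ∀ r ∉ K, H r = 0) (hL0 : ∀ r, ∀ s ∉ L, H r s = 0)
    (F : C_c(G, X)) (hF : ∀ s, F s = ∫ r, H r s ∂μ) :
    ∫ r, toBeurling μ ω (H r) ∂μ = toBeurling μ ω F := by
  -- Point evaluation is not available on `L¹(G, X, ω)`, so the integral is taken among bounded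
  -- continuous functions, a Banach space on which evaluation is continuous. Multiplication by a
  -- cutoff χ equal to 1 on L then maps it boundedly into `L¹(G, X, ω)` and leaves functions
  -- supported in L unchanged.
  obtain ⟨χ₀, hχ1, -, hχc, hχ⟩ := exists_continuous_one_zero_of_isCompact hL isClosed_empty
    (disjoint_empty L)
  let χ : C_c(G, ℝ) := ⟨χ₀, hχc⟩
  have hχ' : ∀ s, ‖χ s‖ ≤ 1 := fun s => by
    change ‖χ₀ s‖ ≤ 1
    rw [Real.norm_of_nonneg (hχ s).1]
    exact (hχ s).2
  have hcont := continuous_toBoundedContinuousFunction hc hL hL0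
  have hint : Integrable (fun r => (H r).toBoundedContinuousFunction) μ :=
    hcont.integrable_of_hasCompactSupport (HasCompactSupport.intro hK fun r hr => by
      rw [hK0 r hr]; rfl)
  have hone : ∀ s (x : X), (s ∉ L → x = 0) → χ s • x = x := fun s x hx => by
    by_cases hs : s ∈ L
    · rw [show χ s = 1 from hχ1 hs, one_smul]
    · rw [hx hs, smul_zero]
  have h1 : ∀ r, toBeurling μ ω (H r) = cutoff μ ω hχ' (H r).toBoundedContinuousFunction :=
    fun r => (cutoff_eq μ ω hχ' _ _ fun s => hone s _ (hL0 r s)).symm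
  have h2 : ∀ s, (∫ r, (H r).toBoundedContinuousFunction ∂μ) s = F s := fun s => by
    rw [hF]
    exact ((BoundedContinuousFunction.evalCLM ℝ s).integral_comp_comm hint).symm
  simp only [h1]
  rw [ContinuousLinearMap.integral_comp_comm _ hint]
  refine cutoff_eq μ ω hχ' _ _ fun s => ?_
  rw [h2]
  refine hone s _ fun hs => ?_
  rw [hF]
  simp only [hL0 _ s hs, integral_zero]

end Beurling

end OrderedCrossedProduct

namespace OrderedCrossedProduct

/-! ### Approximate identities on the group and in the algebra -/

section Bump

variable {G : Type*} [Group G] [TopologicalSpace G] [IsTopologicalGroup G] [LocallyCompactSpace G]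
  [T2Space G] [MeasurableSpace G] [BorelSpace G] (μ : Measure G) [μ.IsHaarMeasure] [μ.Regular]

/-- Inversion need not preserve left Haar measure. Symmetry of z makes `r ↦ z(r⁻¹ s)` a left
translate of z, so that it still has integral 1 and no modular function appears. It is obtained by
symmetrizing a bump supported in `V ∩ V⁻¹`. -/
theorem exists_symmetric_bump {V : Set G} (hV : V ∈ 𝓝 (1 : G)) :
    ∃ z : C_c(G, ℝ), (∀ s, 0 ≤ z s) ∧ (∀ s ∉ V, z s = 0) ∧ (∀ s, z s⁻¹ = z s) ∧
      ∫ s, z s ∂μ = 1 := by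
  have hV' : V ∩ V⁻¹ ∈ 𝓝 (1 : G) := inter_mem hV (inv_mem_nhds_one G hV)
  obtain ⟨g, hg1, hg0, hgc, hg⟩ := exists_continuous_one_zero_of_isCompact
    (isCompact_singleton (x := (1 : G))) (isOpen_interior (s := V ∩ V⁻¹)).isClosed_compl
    (disjoint_compl_right_iff_subset.2 (singleton_subset_iff.2 (mem_interior_iff_mem_nhds.2 hV')))
  have hg0' : ∀ s, s ∉ V ∩ V⁻¹ → g s = 0 := fun s hs => hg0 fun h => hs (interior_subset h)
  let w : G → ℝ := fun s => g s + g s⁻¹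
  have hwc : Continuous w := g.continuous.add (g.continuous.comp continuous_inv)
  have hws : HasCompactSupport w := hgc.add (hgc.comp_homeomorph (Homeomorph.inv G))
  have hw0 : 0 ≤ w := fun s => add_nonneg (hg s).1 (hg s⁻¹).1
  have hpos : 0 < ∫ s, w s ∂μ := by
    refine hwc.integral_pos_of_hasCompactSupport_nonneg_nonzero hws hw0 (x := 1) ?_
    have : g 1 = 1 := hg1 rfl
    simp [w, this]
  refine ⟨⟨⟨fun s => w s / ∫ s, w s ∂μ, hwc.div_const _⟩, ?_⟩,
    fun s => div_nonneg (hw0 s) hpos.le, fun s hs => ?_, fun s => ?_, ?_⟩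
  · refine HasCompactSupport.intro hws.isCompact fun s hs => ?_
    simp only [image_eq_zero_of_notMem_tsupport hs, zero_div]
  · have h1 : g s = 0 := hg0' s fun h => hs h.1
    have h2 : g s⁻¹ = 0 := hg0' s⁻¹ fun h => hs (by simpa using h.2)
    change (g s + g s⁻¹) / _ = 0
    simp [h1, h2]
  · change (g s⁻¹ + g s⁻¹⁻¹) / _ = (g s + g s⁻¹) / _
    rw [inv_inv, add_comm]
  · change ∫ s, w s / _ ∂μ = 1
    rw [integral_div, div_self hpos.ne']

/-- For t in a compact neighbourhood L of e, both terms vanish outside the compact set `tsupport f *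
L`, on which continuity at `t = 1` is uniform. -/
theorem exists_nhds_translate_sub_le {X : Type*} [NormedAddCommGroup X] (f : C_c(G, X)) {ε : ℝ}
    (hε : 0 < ε) : ∃ V ∈ 𝓝 (1 : G), ∀ t ∈ V, ∀ s, ‖f (s * t⁻¹) - f s‖ ≤ ε := by
  obtain ⟨L, hL, hLn⟩ := exists_compact_mem_nhds (1 : G)
  have h1 : ∀ᶠ t in 𝓝 (1 : G), ∀ s ∈ tsupport f * L, ‖f (s * t⁻¹) - f s‖ < ε := by
    refine (f.hasCompactSupport.isCompact.mul hL).eventually_forall_of_forall_eventually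
      fun s _ => ?_
    have h2 : Continuous fun q : G × G => ‖f (q.2 * q.1⁻¹) - f q.2‖ := by
      have := f.continuous
      fun_prop
    refine h2.continuousAt.eventually_lt continuousAt_const ?_
    simpa using hε
  refine ⟨_, inter_mem hLn h1, fun t ht s => ?_⟩
  by_cases hs : s ∈ tsupport f * L
  · exact (ht.2 s hs).le
  · have h3 : f s = 0 := image_eq_zero_of_notMem_tsupport fun h =>
      hs ⟨s, h, 1, mem_of_mem_nhds hLn, mul_one s⟩
    have h4 : f (s * t⁻¹) = 0 := image_eq_zero_of_notMem_tsupport fun h =>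
      hs ⟨_, h, t, ht.1, by simp⟩
    rw [h3, h4, sub_zero, norm_zero]
    exact hε.le

theorem integrable_comp_inv_mul_smul {X : Type*} [NormedAddCommGroup X] [NormedSpace ℝ X]
    (z : C_c(G, ℝ)) (s : G) {f : G → X} (hf : Continuous f) :
    Integrable (fun r => z (r⁻¹ * s) • f r) μ := by
  refine Continuous.integrable_of_hasCompactSupport ?_ ?_
  · have := z.continuous
    fun_prop
  · exact (z.hasCompactSupport.comp_homeomorph
      ((Homeomorph.inv G).trans (Homeomorph.mulRight s))).smul_right

theorem integral_comp_inv_mul {z : G → ℝ} (hz : ∀ s, z s⁻¹ = z s) (s : G) :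
    ∫ r, z (r⁻¹ * s) ∂μ = ∫ r, z r ∂μ := by
  rw [← integral_mul_left_eq_self z s⁻¹]
  refine integral_congr_ae (Eventually.of_forall fun r => ?_)
  simp only
  rw [← hz, mul_inv_rev, inv_inv]

/-- Convolution with a symmetric normalized bump function supported near the identity is
uniformly close to the identity. -/
theorem norm_integral_bump_sub_le {X : Type*} [NormedAddCommGroup X] [NormedSpace ℝ X]
    [CompleteSpace X] (f : C_c(G, X)) {ε : ℝ} {V : Set G}
    (hV : ∀ t ∈ V, ∀ s, ‖f (s * t⁻¹) - f s‖ ≤ ε) {z : C_c(G, ℝ)} (hz0 : ∀ s, 0 ≤ z s)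
    (hzV : ∀ s ∉ V, z s = 0) (hzs : ∀ s, z s⁻¹ = z s) (hz1 : ∫ s, z s ∂μ = 1) (s : G) :
    ‖∫ r, z (r⁻¹ * s) • f r ∂μ - f s‖ ≤ ε := by
  have h1 : ∫ r, z (r⁻¹ * s) ∂μ = 1 := (integral_comp_inv_mul μ hzs s).trans hz1
  have hzi : Integrable (fun r => z (r⁻¹ * s)) μ := by
    simpa using integrable_comp_inv_mul_smul μ z s (continuous_const (y := (1 : ℝ)))
  have h2 : f s = ∫ r, z (r⁻¹ * s) • f s ∂μ := by rw [integral_smul_const, h1, one_smul]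
  have h3 : ∫ r, z (r⁻¹ * s) • f r ∂μ - f s = ∫ r, z (r⁻¹ * s) • (f r - f s) ∂μ := by
    nth_rewrite 1 [h2]
    rw [← integral_sub (integrable_comp_inv_mul_smul μ z s (map_continuous f))
      (integrable_comp_inv_mul_smul μ z s continuous_const)]
    simp only [smul_sub]
  rw [h3]
  calc _ ≤ ∫ r, z (r⁻¹ * s) * ε ∂μ := by
        refine norm_integral_le_of_norm_le (hzi.mul_const ε) (Eventually.of_forall fun r => ?_)
        rw [norm_smul, Real.norm_of_nonneg (hz0 _)]
        by_cases hr : r⁻¹ * s ∈ V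
        · refine mul_le_mul_of_nonneg_left ?_ (hz0 _)
          -- With `t = r⁻¹ s` one has `s t⁻¹ = r`.
          simpa using hV _ hr s
        · rw [hzV _ hr, zero_mul, zero_mul]
    _ = ε := by rw [integral_mul_const, h1, one_mul]

end Bump

/-- An approximate right identity acts as such uniformly on the values of a compactly supported
continuous function. -/
theorem HasApproxRightIdentity.exists_uniform {A : Type u} [NonUnitalNormedRing A]
    {G : Type v} [TopologicalSpace G] {M : ℝ} {P : Set A} (hA : HasApproxRightIdentity.{w} M P)
    (k : C_c(G, A)) {δ : ℝ} (hδ : 0 < δ) :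
    ∃ u ∈ P, ‖u‖ ≤ M ∧ ∀ s, ‖k s * u - k s‖ ≤ δ := by
  obtain ⟨ι, _, _, _, u, hu, hlim⟩ := hA
  have hM : 0 ≤ M := (norm_nonneg _).trans (hu (Classical.arbitrary ι)).2
  -- Replacing a value of k by a point x of the finite net costs at most `‖k s - x‖ (M + 1)`; this
  -- radius keeps that cost below `δ / 2`.
  have hη : 0 < δ / 2 / (M + 1) := by positivity
  obtain ⟨t, -, htf, ht⟩ := (k.hasCompactSupport.isCompact.image k.continuous).finite_cover_balls hη
  have h1 : ∀ᶠ i in atTop, ∀ x ∈ t, ‖x * u i - x‖ < δ / 2 := by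
    refine (eventually_all_finite htf).2 fun x _ => ?_
    have := Metric.tendsto_nhds.1 (hlim x) _ (half_pos hδ)
    simpa only [dist_eq_norm] using this
  obtain ⟨i, hi⟩ := h1.exists
  refine ⟨u i, (hu i).1, (hu i).2, fun s => ?_⟩
  by_cases hs : s ∈ tsupport k
  · obtain ⟨x, hx, hxs⟩ := mem_iUnion₂.1 (ht (mem_image_of_mem k hs))
    rw [Metric.mem_ball, dist_eq_norm] at hxs
    calc ‖k s * u i - k s‖ = ‖((k s - x) * u i - (k s - x)) + (x * u i - x)‖ := by
          congr 1; noncomm_ring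
      _ ≤ ‖k s - x‖ * M + ‖k s - x‖ + ‖x * u i - x‖ := by
          refine (norm_add_le _ _).trans (add_le_add_left ((norm_sub_le _ _).trans
            (add_le_add_left ((norm_mul_le _ _).trans ?_) _)) _)
          exact mul_le_mul_of_nonneg_left (hu i).2 (norm_nonneg _)
      _ ≤ δ / 2 / (M + 1) * (M + 1) + δ / 2 := by
          have := mul_le_mul_of_nonneg_right hxs.le (by positivity : 0 ≤ M + 1)
          linarith [hi x hx]
      _ = δ := by field_simp; ring
  · rw [image_eq_zero_of_notMem_tsupport hs, zero_mul, sub_zero, norm_zero]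
    exact hδ.le

/-! ### The twist and the integrated form of `(λ̃, Λ)` -/

section Twist

variable {A G : Type*} [NonUnitalNormedRing A] [NormedSpace ℝ A] [IsScalarTower ℝ A A]
  [SMulCommClass ℝ A A] [CompleteSpace A] [Group G] [TopologicalSpace G] [IsTopologicalGroup G]
  [LocallyCompactSpace G] [T2Space G] [MeasurableSpace G] [BorelSpace G]
  (μ : Measure G) [μ.IsHaarMeasure] [μ.Regular] (ω : Weight G) (S : PreorderedSystem A G)

/-- The operator `h ↦ (s ↦ α_s(h(s)))` on `C_c(G, A)`. -/
def untwistCc : C_c(G, A) →ₗ[ℝ] C_c(G, A) where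
  toFun h :=
    { toFun := fun s => S.act s (h s)
      continuous_toFun := S.continuous_act_uncurry.comp (continuous_id.prodMk h.continuous)
      hasCompactSupport' := HasCompactSupport.intro h.hasCompactSupport fun s hs => by
        rw [image_eq_zero_of_notMem_tsupport hs, map_zero] }
  map_add' _ _ := by ext s; exact map_add (S.act s) _ _
  map_smul' _ _ := by ext s; exact map_smul (S.act s) _ _

/-- The operator `h ↦ (s ↦ α_s⁻¹(h(s)))` on `C_c(G, A)`. -/
def twistCc : C_c(G, A) →ₗ[ℝ] C_c(G, A) where
  toFun h :=
    { toFun := fun s => S.act s⁻¹ (h s)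
      continuous_toFun := S.continuous_act_uncurry.comp (continuous_inv.prodMk h.continuous)
      hasCompactSupport' := HasCompactSupport.intro h.hasCompactSupport fun s hs => by
        rw [image_eq_zero_of_notMem_tsupport hs, map_zero] }
  map_add' _ _ := by ext s; exact map_add (S.act s⁻¹) _ _
  map_smul' _ _ := by ext s; exact map_smul (S.act s⁻¹) _ _

theorem untwistCc_apply (h : C_c(G, A)) (s : G) : untwistCc S h s = S.act s (h s) := rfl

theorem twistCc_apply (h : C_c(G, A)) (s : G) : twistCc S h s = S.act s⁻¹ (h s) := rfl

theorem untwistCc_twistCc (h : C_c(G, A)) : untwistCc S (twistCc S h) = h := by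
  ext s
  rw [untwistCc_apply, twistCc_apply, S.act_act, mul_inv_cancel, S.act_one]

theorem twistCc_untwistCc (h : C_c(G, A)) : twistCc S (untwistCc S h) = h := by
  ext s
  rw [twistCc_apply, untwistCc_apply, S.act_act, inv_mul_cancel, S.act_one]

theorem weightedNorm_le_of_norm_le {C : ℝ} {h k : C_c(G, A)} (hk : ∀ s, ‖k s‖ ≤ C * ‖h s‖) :
    weightedNorm μ ω A k ≤ C * weightedNorm μ ω A h := by
  rw [weightedNorm_apply, weightedNorm_apply, ← integral_const_mul]
  refine integral_mono (ω.integrable μ k) ((ω.integrable μ h).const_mul _) fun s => ?_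
  simp only [← mul_assoc]
  exact mul_le_mul_of_nonneg_right (hk s) (ω.nonneg' s)

theorem weightedNorm_untwistCc_le {C : ℝ} (hC : ∀ s, ‖S.act s‖ ≤ C) (h : C_c(G, A)) :
    weightedNorm μ ω A (untwistCc S h) ≤ C * weightedNorm μ ω A h :=
  weightedNorm_le_of_norm_le μ ω fun s => (S.act s).le_of_opNorm_le (hC s) _

theorem weightedNorm_twistCc_le {C : ℝ} (hC : ∀ s, ‖S.act s‖ ≤ C) (h : C_c(G, A)) :
    weightedNorm μ ω A (twistCc S h) ≤ C * weightedNorm μ ω A h :=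
  weightedNorm_le_of_norm_le μ ω fun s => (S.act s⁻¹).le_of_opNorm_le (hC s⁻¹) _

/-- The function `s ↦ z(s) a`. -/
def tensorCc (z : C_c(G, ℝ)) (a : A) : C_c(G, A) where
  toFun s := z s • a
  continuous_toFun := z.continuous.smul continuous_const
  hasCompactSupport' := z.hasCompactSupport.smul_right

theorem tensorCc_apply (z : C_c(G, ℝ)) (a : A) (s : G) : tensorCc z a s = z s • a := rfl

/-- As z has mass 1 and vanishes off V, only the size of ω on V matters. This is how the weight near
e enters the constants. -/
theorem weightedNorm_tensorCc_le {z : C_c(G, ℝ)} (hz0 : ∀ s, 0 ≤ z s) (hz1 : ∫ s, z s ∂μ = 1)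
    {V : Set G} (hzV : ∀ s ∉ V, z s = 0) {B M : ℝ} (hB : ∀ s ∈ V, ω s ≤ B) {a : A}
    (ha : ‖a‖ ≤ M) : weightedNorm μ ω A (tensorCc z a) ≤ M * B := by
  have hzi : Integrable (fun s => z s) μ :=
    z.continuous.integrable_of_hasCompactSupport z.hasCompactSupport
  calc weightedNorm μ ω A (tensorCc z a) ≤ ∫ s, M * B * z s ∂μ := by
        rw [weightedNorm_apply]
        refine integral_mono (ω.integrable μ _) (hzi.const_mul _) fun s => ?_
        simp only [tensorCc_apply, norm_smul, Real.norm_of_nonneg (hz0 s)]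
        by_cases hs : s ∈ V
        · calc z s * ‖a‖ * ω s ≤ z s * M * B := mul_le_mul
                (mul_le_mul_of_nonneg_left ha (hz0 s)) (hB s hs) (ω.nonneg' s)
                (mul_nonneg (hz0 s) ((norm_nonneg a).trans ha))
            _ = _ := by ring
        · simp [hzV s hs]
    _ = M * B := by rw [integral_const_mul, hz1, mul_one]

/-- On `C_c(G, A)`, the integrated form of `(λ̃, Λ)` is the twisted convolution, conjugated by the
twist. -/
theorem integrated_regularRep_toBeurling (hS : S.UniformlyBounded) (f h : C_c(G, A)) :
    (regularRep μ ω S hS).integrated μ f (toBeurling μ ω h) =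
      toBeurling μ ω (twistCc S (twistedConv μ S f (untwistCc S h))) := by
  rw [CovRep.integrated_apply]
  have h1 : ∀ r, (regularRep μ ω S hS).alg (f r) ((regularRep μ ω S hS).grp r (toBeurling μ ω h)) =
      toBeurling μ ω (inducedAlgCc S (ContinuousLinearMap.mul ℝ A) (f r) (translationCc r h)) :=
    fun r => by rw [regularRep, inducedRep_grp_apply, inducedRep_alg_apply]
  have h2 : ∀ r s, inducedAlgCc S (ContinuousLinearMap.mul ℝ A) (f r) (translationCc r h) s =
      S.act s⁻¹ (f r) * h (r⁻¹ * s) := fun _ _ => rfl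
  -- Since `s⁻¹ · r · (r⁻¹ s) = e`, the factor `h(r⁻¹ s)` can be written with `α_s⁻¹` in front, and
  -- the multiplicative `α_s⁻¹` comes out of the product.
  have h3 : ∀ r s, S.act s⁻¹ (f r) * h (r⁻¹ * s) =
      S.act s⁻¹ (f r * S.act r (untwistCc S h (r⁻¹ * s))) := fun r s => by
    rw [untwistCc_apply, S.act_act, mul_inv_cancel_left, S.act_mul, S.act_act, inv_mul_cancel,
      S.act_one]
  simp only [h1]
  refine integral_toBeurling μ ω (K := tsupport f) (L := tsupport f * tsupport h) ?_
    f.hasCompactSupport.isCompact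
    (f.hasCompactSupport.isCompact.mul h.hasCompactSupport.isCompact) (fun r hr => ?_)
    (fun r s hs => ?_) _ fun s => ?_
  · simp only [h2]
    exact (S.continuous_act_uncurry.comp (continuous_snd.inv.prodMk
      (f.continuous.comp continuous_fst))).mul
      (h.continuous.comp (continuous_fst.inv.mul continuous_snd))
  · ext s
    rw [h2, image_eq_zero_of_notMem_tsupport hr, map_zero, zero_mul]
    rfl
  · rw [h2]
    by_cases hr : r ∈ tsupport f
    · rw [image_eq_zero_of_notMem_tsupport (f := h) fun ht => hs ⟨r, hr, _, ht, by simp⟩, mul_zero]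
    · rw [image_eq_zero_of_notMem_tsupport hr, map_zero, zero_mul]
  · simp only [h2, h3]
    rw [twistCc_apply, twistedConv_apply]
    exact ((S.act s⁻¹).integral_comp_comm (integrable_convIntegrand μ S f _ s)).symm

/-- Untwisting removes the dependence on r: `α_r(α_{r⁻¹s}(a)) = α_s(a)`. This factor leaves the
integral on the right, and the outer `α_s⁻¹` turns it back into a. -/
theorem twistedConv_untwistCc_tensorCc (f : C_c(G, A)) (z : C_c(G, ℝ)) (a : A) (s : G) :
    twistCc S (twistedConv μ S f (untwistCc S (tensorCc z a))) s =
      S.act s⁻¹ (∫ r, z (r⁻¹ * s) • f r ∂μ) * a := by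
  have h1 : ∀ r, f r * S.act r (untwistCc S (tensorCc z a) (r⁻¹ * s)) =
      (z (r⁻¹ * s) • f r) * S.act s a := fun r => by
    rw [untwistCc_apply, S.act_act, mul_inv_cancel_left, tensorCc_apply, map_smul, mul_smul_comm,
      smul_mul_assoc]
  rw [twistCc_apply, twistedConv_apply]
  simp only [h1]
  have h2 := ((ContinuousLinearMap.mul ℝ A).flip (S.act s a)).integral_comp_comm
    (integrable_comp_inv_mul_smul μ z s (map_continuous f))
  simp only [ContinuousLinearMap.flip_apply, ContinuousLinearMap.mul_apply'] at h2
  rw [h2, S.act_mul, S.act_act, inv_mul_cancel, S.act_one]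

/-- Applied to suitable elementary tensors, `(λ̃ ⋊ Λ)(f)` approximates the twist of `f`. -/
theorem exists_integrated_tensorCc_approx (hS : S.UniformlyBounded) {M : ℝ} {P : Set A}
    (hA : HasApproxRightIdentity.{w} M P) {V : Set G} (hV : V ∈ 𝓝 (1 : G)) (f : C_c(G, A))
    {ε : ℝ} (hε : 0 < ε) : ∃ (z : C_c(G, ℝ)) (u : A), (∀ s, 0 ≤ z s) ∧ (∀ s ∉ V, z s = 0) ∧
      ∫ s, z s ∂μ = 1 ∧ u ∈ P ∧ ‖u‖ ≤ M ∧
      ‖(regularRep μ ω S hS).integrated μ f (toBeurling μ ω (tensorCc z u)) -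
        toBeurling μ ω (twistCc S f)‖ ≤ ε := by
  obtain ⟨C, hC⟩ := id hS
  have hC0 : 0 ≤ C := (norm_nonneg _).trans (hC 1)
  obtain ⟨L, hL, hLn⟩ := exists_compact_mem_nhds (1 : G)
  have hK : IsCompact (tsupport f * L) := f.hasCompactSupport.isCompact.mul hL
  -- The bump will be supported in L, so the error lives on `tsupport f * L` and a uniform bound `ε
  -- / (N + 1)` for it gives a norm at most ε.
  set N := (ω.measure μ).real (tsupport f * L) with hN
  have hN0 : 0 ≤ N := measureReal_nonneg
  have hδ : 0 < ε / (N + 1) := by positivity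
  obtain ⟨u, huP, huM, hu⟩ := hA.exists_uniform (twistCc S f) (half_pos hδ)
  have hM : 0 ≤ M := (norm_nonneg u).trans huM
  -- The error of the bump passes through `α_s⁻¹` and is multiplied by u, which costs a factor `C *
  -- M`; dividing by `C * M + 1` compensates for it.
  obtain ⟨W, hW, hWf⟩ := exists_nhds_translate_sub_le f
    (show 0 < ε / (N + 1) / 2 / (C * M + 1) by positivity)
  obtain ⟨z, hz0, hzV, hzs, hz1⟩ := exists_symmetric_bump μ (inter_mem hV (inter_mem hLn hW))
  refine ⟨z, u, hz0, fun s hs => hzV s fun h => hs h.1, hz1, huP, huM, ?_⟩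
  rw [integrated_regularRep_toBeurling, ← map_sub, toBeurling, norm_toCompl]
  -- The error splits into that of the bump convolution, multiplied by u, and that of u as a right
  -- identity on the values of `twistCc S f`.
  have hval : ∀ s, (twistCc S (twistedConv μ S f (untwistCc S (tensorCc z u))) - twistCc S f) s =
      S.act s⁻¹ (∫ r, z (r⁻¹ * s) • f r ∂μ - f s) * u +
        (twistCc S f s * u - twistCc S f s) := fun s => by
    rw [CompactlySupportedContinuousMap.sub_apply, twistedConv_untwistCc_tensorCc, twistCc_apply,
      map_sub, sub_mul]
    abel
  have hzL : ∀ s ∉ L, z s = 0 := fun s hs => hzV s fun h => hs h.2.1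
  refine (weightedNorm_le_of_bound μ ω hK _ (fun s hs => ?_) (ε := ε / (N + 1)) fun s => ?_).trans ?_
  · have h1 : f s = 0 := image_eq_zero_of_notMem_tsupport fun h =>
      hs ⟨s, h, 1, mem_of_mem_nhds hLn, mul_one s⟩
    have h2 : ∀ r, z (r⁻¹ * s) • f r = 0 := fun r => by
      by_cases hr : r ∈ tsupport f
      · rw [hzL _ fun h => hs ⟨r, hr, _, h, by simp⟩, zero_smul]
      · rw [image_eq_zero_of_notMem_tsupport hr, smul_zero]
    rw [hval, twistCc_apply, h1]
    simp [h2]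
  · rw [hval]
    have h1 := norm_integral_bump_sub_le μ f (V := V ∩ (L ∩ W))
      (fun t ht => hWf t ht.2.2) hz0 hzV hzs hz1 s
    calc _ ≤ C * (ε / (N + 1) / 2 / (C * M + 1)) * M + ε / (N + 1) / 2 := by
          refine (norm_add_le _ _).trans (add_le_add ((norm_mul_le _ _).trans ?_) (hu s))
          refine mul_le_mul ?_ huM (norm_nonneg _) (by positivity)
          exact ((S.act s⁻¹).le_of_opNorm_le (hC _) _).trans (mul_le_mul_of_nonneg_left h1 hC0)
      _ = ε / (N + 1) / 2 * (C * M / (C * M + 1)) + ε / (N + 1) / 2 := by ring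
      _ ≤ ε / (N + 1) / 2 * 1 + ε / (N + 1) / 2 := by
          gcongr
          exact div_le_one_of_le₀ (by linarith) (by positivity)
      _ = _ := by ring
  · rw [← hN, div_mul_eq_mul_div, div_le_iff₀ (by positivity)]
    nlinarith

end Twist

end OrderedCrossedProduct

namespace OrderedCrossedProduct

/-! ### Positivity, non-degeneracy and norm estimates for `(λ̃, Λ)` -/

section Regular

variable {A G : Type*} [NonUnitalNormedRing A] [NormedSpace ℝ A] [IsScalarTower ℝ A A]
  [SMulCommClass ℝ A A] [CompleteSpace A] [Group G] [TopologicalSpace G] [IsTopologicalGroup G]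
  [LocallyCompactSpace G] [T2Space G] [MeasurableSpace G] [BorelSpace G]
  (μ : Measure G) [μ.IsHaarMeasure] [μ.Regular] (ω : Weight G) {S : PreorderedSystem A G}
  (hS : S.UniformlyBounded)

theorem regularRep_positive : (regularRep μ ω S hS).Positive (beurlingCone μ ω S.cone) := by
  refine ⟨fun a ha x hx => ?_, fun r x hx => ?_⟩
  · refine complCone_induction _ (isClosed_complCone _ _)
      ((regularRep μ ω S hS).alg a).continuous (fun h hh => ?_) hx
    change (regularRep μ ω S hS).alg a (toBeurling μ ω h) ∈ _
    rw [regularRep, inducedRep_alg_apply]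
    exact toCompl_mem_complCone _ fun s =>
      S.mul_mem_cone _ (S.act_mem_cone _ a ha) _ (hh s)
  · refine complCone_induction _ (isClosed_complCone _ _)
      ((regularRep μ ω S hS).grp r).continuous (fun h hh => ?_) hx
    change (regularRep μ ω S hS).grp r (toBeurling μ ω h) ∈ _
    rw [regularRep, inducedRep_grp_apply]
    exact toCompl_mem_complCone _ fun s => hh (r⁻¹ * s)

theorem CovRep.Positive.integrated_mem {X : Type*} [NormedAddCommGroup X] [NormedSpace ℝ X]
    [CompleteSpace X] {ρ : CovRep S X} {C : PointedCone ℝ X} (hρ : ρ.Positive C)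
    (hC : IsClosed (C : Set X)) {f : C_c(G, A)} (hf : f ∈ ccCone S.cone) :
    ρ.integrated μ f ∈ operatorCone C := fun x hx => by
  rw [CovRep.integrated_apply]
  refine integral_mem_of_isClosed_cone μ hC (ρ.integrable_integrand μ f x)
    f.hasCompactSupport.isCompact (fun r hr => ?_) fun r => hρ.1 _ (hf r) _ (hρ.2 r x hx)
  rw [image_eq_zero_of_notMem_tsupport hr, map_zero, zero_apply]

theorem CovRep.integrated_mem_closure_span {X : Type*} [NormedAddCommGroup X] [NormedSpace ℝ X]
    [CompleteSpace X] (ρ : CovRep S X) (f : C_c(G, A)) (x : X) :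
    ρ.integrated μ f x ∈
      (Submodule.span ℝ {y : X | ∃ a x, y = ρ.alg a x}).topologicalClosure := by
  rw [CovRep.integrated_apply]
  -- A closed subspace is in particular a closed cone.
  refine integral_mem_of_isClosed_cone μ
    (C := PointedCone.ofSubmodule (Submodule.topologicalClosure _))
    (Submodule.isClosed_topologicalClosure _) (ρ.integrable_integrand μ f x)
    f.hasCompactSupport.isCompact (fun r hr => ?_)
    fun r => Submodule.le_topologicalClosure _ (Submodule.subset_span ⟨_, _, rfl⟩)
  rw [image_eq_zero_of_notMem_tsupport hr, map_zero, zero_apply]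

/-- Every h in `C_c(G, A)` is the twist of `untwistCc S h`, hence a limit of vectors `(λ̃ ⋊ Λ)(f) x`
with `f = untwistCc S h`; these lie in the closed span of the ranges of the `λ̃(a)`. -/
theorem regularRep_nondegenerate {M : ℝ} {P : Set A} (hA : HasApproxRightIdentity.{w} M P) :
    (regularRep μ ω S hS).Nondegenerate := by
  rw [CovRep.Nondegenerate, dense_iff_closure_eq, ← Submodule.topologicalClosure_coe]
  set Y := (Submodule.span ℝ {y | ∃ a x, y = (regularRep μ ω S hS).alg a x}).topologicalClosure
  have hYc : IsClosed (Y : Set (BeurlingSpace μ ω A)) := Submodule.isClosed_topologicalClosure _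
  refine eq_univ_of_univ_subset ?_
  rw [← (denseRange_toCompl (weightedNorm μ ω A)).closure_range]
  refine closure_minimal ?_ hYc
  rintro _ ⟨h, rfl⟩
  rw [← hYc.closure_eq, Metric.mem_closure_iff]
  intro ε hε
  obtain ⟨z, u, -, -, -, -, -, hzu⟩ := exists_integrated_tensorCc_approx μ ω S hS hA univ_mem
    (untwistCc S h) (half_pos hε)
  refine ⟨_, CovRep.integrated_mem_closure_span μ (regularRep μ ω S hS) (untwistCc S h)
    (toBeurling μ ω (tensorCc z u)), ?_⟩
  rw [twistCc_untwistCc, ← dist_eq_norm, dist_comm] at hzu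
  exact hzu.trans_lt (half_lt_self hε)

theorem norm_regularRep_alg_le {C : ℝ} (hC : ∀ s, ‖S.act s‖ ≤ C) :
    ‖(regularRep μ ω S hS).alg‖ ≤ C := by
  have hC0 : 0 ≤ C := (norm_nonneg _).trans (hC 1)
  refine ContinuousLinearMap.opNorm_le_bound _ hC0 fun a =>
    norm_mapCompl_le _ _ (by positivity) fun h => ?_
  refine (weightedNorm_inducedAlg_le μ ω S _ hC a h).trans ?_
  refine mul_le_mul_of_nonneg_right ?_ (apply_nonneg _ h)
  rw [mul_assoc]
  exact mul_le_of_le_one_left (by positivity) (ContinuousLinearMap.opNorm_mul_le ℝ A)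

/-- The weight in `‖·‖_{1,ω}` is precisely the bound for `‖Λ_r‖`, so the integrand is dominated by
`C ‖f(r)‖ ω(r) ‖x‖`. -/
theorem norm_integrated_regularRep_le {C : ℝ} (hC : ∀ s, ‖S.act s‖ ≤ C) (f : C_c(G, A)) :
    ‖(regularRep μ ω S hS).integrated μ f‖ ≤ C * weightedNorm μ ω A f := by
  have hC0 : 0 ≤ C := (norm_nonneg _).trans (hC 1)
  refine ContinuousLinearMap.opNorm_le_bound _ (mul_nonneg hC0 (apply_nonneg _ f)) fun x => ?_
  rw [CovRep.integrated_apply]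
  calc _ ≤ ∫ r, C * ‖x‖ * (‖f r‖ * ω r) ∂μ := by
        refine norm_integral_le_of_norm_le ((ω.integrable μ f).const_mul _)
          (Eventually.of_forall fun r => ?_)
        have h1 : ‖(regularRep μ ω S hS).alg (f r)‖ ≤ C * ‖f r‖ :=
          ContinuousLinearMap.le_of_opNorm_le _ (norm_regularRep_alg_le μ ω hS hC) _
        have h2 : ‖(regularRep μ ω S hS).grp r x‖ ≤ ω r * ‖x‖ :=
          ContinuousLinearMap.le_of_opNorm_le _ (norm_regularRep_grp_le μ ω S hS r) _
        calc _ ≤ C * ‖f r‖ * (ω r * ‖x‖) := (ContinuousLinearMap.le_opNorm _ _).trans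
              (mul_le_mul h1 h2 (norm_nonneg _) (by positivity))
          _ = _ := by ring
    _ = _ := by rw [integral_const_mul, weightedNorm_apply]; ring

/-- Testing the operator on vectors `z ⊗ u` of norm at most `M * B` recovers the twist of f up to ε;
undoing the twist costs the factor C. The neighbourhood V is left free so that B can later be pushed
down to 1. -/
theorem weightedNorm_le_norm_integrated {C : ℝ} (hC : ∀ s, ‖S.act s‖ ≤ C) {M : ℝ} {P : Set A}
    (hA : HasApproxRightIdentity.{w} M P) {V : Set G} (hV : V ∈ 𝓝 (1 : G)) {B : ℝ}
    (hB : ∀ s ∈ V, ω s ≤ B) (f : C_c(G, A)) :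
    weightedNorm μ ω A f ≤ C * (M * B) * ‖(regularRep μ ω S hS).integrated μ f‖ := by
  have hC0 : 0 ≤ C := (norm_nonneg _).trans (hC 1)
  have h1 : weightedNorm μ ω A (twistCc S f) ≤
      M * B * ‖(regularRep μ ω S hS).integrated μ f‖ := by
    refine le_of_forall_pos_le_add fun ε hε => ?_
    obtain ⟨z, u, hz0, hzV, hz1, -, hu, hzu⟩ :=
      exists_integrated_tensorCc_approx μ ω S hS hA hV f hε
    have h2 : ‖toBeurling μ ω (tensorCc z u)‖ ≤ M * B := by
      rw [toBeurling, norm_toCompl]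
      exact weightedNorm_tensorCc_le μ ω hz0 hz1 hzV hB hu
    have h3 := ((regularRep μ ω S hS).integrated μ f).le_opNorm_of_le h2
    have h4 := norm_le_norm_add_norm_sub' (toBeurling μ ω (twistCc S f))
      ((regularRep μ ω S hS).integrated μ f (toBeurling μ ω (tensorCc z u)))
    rw [norm_sub_rev] at h4
    rw [toBeurling, norm_toCompl] at h4
    rw [toBeurling] at hzu h3
    linarith
  calc weightedNorm μ ω A f = weightedNorm μ ω A (untwistCc S (twistCc S f)) := by
        rw [untwistCc_twistCc]
    _ ≤ C * weightedNorm μ ω A (twistCc S f) := weightedNorm_untwistCc_le μ ω S hC _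
    _ ≤ _ := by
        rw [mul_assoc]
        exact mul_le_mul_of_nonneg_left h1 hC0

/-- A continuous extension of `λ̃ ⋊ Λ` to `L¹(G, A, ω)` reflects positivity if there is a positive
bounded approximate right identity. -/
theorem mem_beurlingCone_of_mem_operatorCone {M : ℝ}
    (hA : HasApproxRightIdentity.{w} M (S.cone : Set A))
    {Θ : BeurlingSpace μ ω A →L[ℝ] BeurlingSpace μ ω A →L[ℝ] BeurlingSpace μ ω A}
    (hΘ : ∀ f, Θ (toBeurling μ ω f) = (regularRep μ ω S hS).integrated μ f)
    {y : BeurlingSpace μ ω A} (hy : Θ y ∈ operatorCone (beurlingCone μ ω S.cone)) :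
    y ∈ beurlingCone μ ω S.cone := by
  obtain ⟨C, hC⟩ := id hS
  have hC0 : 0 ≤ C := (norm_nonneg _).trans (hC 1)
  obtain ⟨L, hL, hLn⟩ := exists_compact_mem_nhds (1 : G)
  obtain ⟨B, hB0, hB⟩ := ω.bddOn_compact μ hL
  have hM : 0 ≤ M := by
    obtain ⟨u, -, hu, -⟩ := hA.exists_uniform (0 : C_c(G, A)) one_pos
    exact (norm_nonneg u).trans hu
  set J := mapCompl (weightedNorm μ ω A) (twistCc S)
  have hJf : ∀ f, J (toBeurling μ ω f) = toBeurling μ ω (twistCc S f) :=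
    mapCompl_toCompl _ _ ⟨_, weightedNorm_twistCc_le μ ω S hC⟩
  set J' := mapCompl (weightedNorm μ ω A) (untwistCc S)
  have hJf' : ∀ f, J' (toBeurling μ ω f) = toBeurling μ ω (untwistCc S f) :=
    mapCompl_toCompl _ _ ⟨_, weightedNorm_untwistCc_le μ ω S hC⟩
  have hJJ : J' (J y) = y := by
    have : J'.comp J = ContinuousLinearMap.id ℝ _ := ext_compl _ fun f => by
      change J' (J (toBeurling μ ω f)) = toBeurling μ ω f
      rw [hJf, hJf', untwistCc_twistCc]
    exact DFunLike.congr_fun this y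
  have hJy : J y ∈ beurlingCone μ ω S.cone := by
    refine (isClosed_complCone (weightedNorm μ ω A) (ccCone S.cone)).closure_subset
      (Metric.mem_closure_iff.2 ?_)
    intro ε hε
    obtain ⟨f, hf⟩ := (denseRange_toCompl (weightedNorm μ ω A)).exists_dist_lt y
      -- Passing from y to f changes both `J y` and `Θ y (z ⊗ u)`, by a total of at most `(‖J‖ + ‖Θ‖
      -- * (M * B)) * ‖y - f‖`, which is kept below `ε / 2`.
      (show 0 < ε / 2 / (‖Θ‖ * (M * B) + ‖J‖ + 1) by positivity)
    change dist y (toBeurling μ ω f) < _ at hf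
    rw [dist_eq_norm, lt_div_iff₀ (by positivity)] at hf
    obtain ⟨z, u, hz0, hzV, hz1, hup, hu, hzu⟩ :=
      exists_integrated_tensorCc_approx μ ω S hS hA hLn f (half_pos hε)
    have h2 : ‖toBeurling μ ω (tensorCc z u)‖ ≤ M * B := by
      rw [toBeurling, norm_toCompl]
      exact weightedNorm_tensorCc_le μ ω hz0 hz1 hzV hB hu
    -- The test vector `z ⊗ u` is positive because z is non-negative and u lies in the cone, so `Θ
    -- y` maps it to a positive vector. The bound for the test vector does not depend on f, which
    -- allows f to be chosen first.
    refine ⟨_, hy _ (toCompl_mem_complCone _ (v := tensorCc z u) fun s =>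
      S.cone.smul_mem' ⟨z s, hz0 s⟩ hup), ?_⟩
    change dist (J y) (Θ y (toBeurling μ ω (tensorCc z u))) < ε
    have h3 : J y - Θ y (toBeurling μ ω (tensorCc z u)) = J (y - toBeurling μ ω f) -
        Θ (y - toBeurling μ ω f) (toBeurling μ ω (tensorCc z u)) -
        ((regularRep μ ω S hS).integrated μ f (toBeurling μ ω (tensorCc z u)) -
          toBeurling μ ω (twistCc S f)) := by
      rw [map_sub, map_sub, hJf, hΘ, sub_apply]
      abel
    rw [dist_eq_norm, h3]
    have h4 := J.le_opNorm (y - toBeurling μ ω f)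
    have h5 : ‖Θ (y - toBeurling μ ω f) (toBeurling μ ω (tensorCc z u))‖ ≤
        ‖Θ‖ * ‖y - toBeurling μ ω f‖ * (M * B) :=
      ContinuousLinearMap.le_of_opNorm_le_of_le _ (Θ.le_opNorm _) h2
    have h6 := norm_nonneg (y - toBeurling μ ω f)
    refine (norm_sub_le _ _).trans_lt ?_
    have h7 := norm_sub_le (J (y - toBeurling μ ω f))
      (Θ (y - toBeurling μ ω f) (toBeurling μ ω (tensorCc z u)))
    linarith
  -- Untwisting preserves the cone, so positivity of `J y` gives that of y.
  rw [← hJJ]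
  refine complCone_induction _ (isClosed_complCone _ _) J'.continuous (fun h hh => ?_) hJy
  change J' (toBeurling μ ω h) ∈ _
  rw [hJf']
  exact toCompl_mem_complCone _ fun s => S.act_mem_cone _ _ (hh s)

/-! ### The crossed product and the maps Φ and Ψ -/

theorem crossedSeminorm_regularClass (f : C_c(G, A)) :
    crossedSeminorm μ (regularClass μ ω S hS) (uniformlyBounded_regularClass μ ω S hS) f =
      ‖(regularRep μ ω S hS).integrated μ f‖ := by
  rw [crossedSeminorm_apply]
  exact ciSup_unique (α := ℝ)
    (ι := ({⟨BeurlingSpace μ ω A, regularRep μ ω S hS⟩} : Set (BanachCovRep S)))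
    (s := fun ρ => ‖ρ.1.rep.integrated μ f‖)

/-- The extension of `λ̃ ⋊ Λ` to the crossed product `(A ⋊_α G)^R`. -/
def crossedRep : CrossedProduct μ (regularClass μ ω S hS) (uniformlyBounded_regularClass μ ω S hS)
    →L[ℝ] (BeurlingSpace μ ω A →L[ℝ] BeurlingSpace μ ω A) :=
  extendCompl _ ((regularRep μ ω S hS).integrated μ)

theorem crossedRep_toCrossed (f : C_c(G, A)) :
    crossedRep μ ω hS (toCrossed μ _ _ f) = (regularRep μ ω S hS).integrated μ f :=
  extendCompl_toCompl _ _ ⟨1, fun f => by rw [one_mul, crossedSeminorm_regularClass]⟩ f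

theorem isometry_of_norm_toCompl {V Y : Type*} [AddCommGroup V] [Module ℝ V]
    [NormedAddCommGroup Y] [NormedSpace ℝ Y] {p : Seminorm ℝ V} (T : Compl p →L[ℝ] Y)
    (h : ∀ v, ‖T (toCompl p v)‖ = p v) : Isometry T := by
  refine AddMonoidHomClass.isometry_of_norm T fun x => ?_
  refine (denseRange_toCompl p).induction_on x
    (isClosed_eq T.continuous.norm continuous_norm) fun v => ?_
  rw [h, norm_toCompl]

/-- For a one-element class `σ^R` is the operator norm of the integrated form. Thus Ψ is isometric
in all cases, without an approximate identity. -/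
theorem isometry_crossedRep : Isometry (crossedRep μ ω hS) :=
  isometry_of_norm_toCompl _ fun f => by
    rw [crossedSeminorm_regularClass]
    exact congrArg _ (crossedRep_toCrossed μ ω hS f)

/-- If the infimum over a neighbourhood base of the suprema of a weight is less than `c`, then the
weight is bounded by `c` near `1`. -/
theorem Weight.exists_mem_forall_le {Z : Set (Set G)} {K : Set G} {B : ℝ} (hB : ∀ s ∈ K, ω s ≤ B)
    (hZK : ∀ W ∈ Z, W ⊆ K) (hZ : (𝓝 (1 : G)).HasBasis (fun W => W ∈ Z) id) {c : ℝ}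
    (h : (⨅ W : Z, ⨆ r : (W : Set G), ω r) < c) : ∃ W ∈ 𝓝 (1 : G), ∀ r ∈ W, ω r ≤ c := by
  obtain ⟨W₀, hW₀, -⟩ := hZ.mem_iff.1 (univ_mem (f := 𝓝 (1 : G)))
  have : Nonempty Z := ⟨⟨W₀, hW₀⟩⟩
  obtain ⟨W, hW⟩ := exists_lt_of_ciInf_lt h
  refine ⟨W, hZ.mem_of_mem W.2, fun r hr => ?_⟩
  -- A real supremum over an unbounded family has the default value 0 and would bound nothing;
  -- containment in K excludes this.
  have hbdd : BddAbove (range fun r : (W : Set G) => ω r) := by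
    refine ⟨B, ?_⟩
    rintro _ ⟨s, rfl⟩
    exact hB s (hZK W W.2 s.2)
  exact (le_ciSup hbdd ⟨r, hr⟩).trans hW.le

theorem crossedRep_mul (x y : CrossedProduct μ (regularClass μ ω S hS)
    (uniformlyBounded_regularClass μ ω S hS)) :
    crossedRep μ ω hS (crossedMul μ _ _ x y) = crossedRep μ ω hS x * crossedRep μ ω hS y := by
  refine (denseRange_toCompl _).induction_on₂ (isClosed_eq (by fun_prop) (by fun_prop))
    (fun f g => ?_) x y
  rw [crossedMul, mulCompl_toCompl]
  exact (crossedRep_toCrossed μ ω hS _).trans ((CovRep.integrated_conv μ _ f g).trans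
    (congrArg₂ _ (crossedRep_toCrossed μ ω hS f) (crossedRep_toCrossed μ ω hS g)).symm)

theorem crossedRep_mem_operatorCone {x : CrossedProduct μ (regularClass μ ω S hS)
    (uniformlyBounded_regularClass μ ω S hS)} (hx : x ∈ crossedCone μ _ _) :
    crossedRep μ ω hS x ∈ operatorCone (beurlingCone μ ω S.cone) := by
  have hcone : IsClosed (beurlingCone μ ω S.cone : Set (BeurlingSpace μ ω A)) :=
    isClosed_complCone _ _
  refine complCone_induction _ (isClosed_operatorCone hcone) (crossedRep μ ω hS).continuous
    (fun f hf => ?_) hx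
  have hf' := (regularRep_positive μ ω hS).integrated_mem μ hcone hf
  rwa [← crossedRep_toCrossed] at hf'

/-- The topological isomorphism from `L¹(G, A, ω)` onto the crossed product that is the identity
on `C_c(G, A)`. -/
theorem exists_beurling_equiv_crossedProduct {M : ℝ} {P : Set A}
    (hA : HasApproxRightIdentity.{w} M P) :
    ∃ Φ : BeurlingSpace μ ω A ≃L[ℝ]
      CrossedProduct μ (regularClass μ ω S hS) (uniformlyBounded_regularClass μ ω S hS),
      ∀ f : C_c(G, A), Φ (toBeurling μ ω f) = toCrossed μ _ _ f := by
  obtain ⟨C, hC⟩ := id hS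
  obtain ⟨L, hL, hLn⟩ := exists_compact_mem_nhds (1 : G)
  obtain ⟨B, -, hB⟩ := ω.bddOn_compact μ hL
  let p := weightedNorm μ ω A
  let q := crossedSeminorm μ (regularClass μ ω S hS) (uniformlyBounded_regularClass μ ω S hS)
  have hq : ∀ f, q f = ‖(regularRep μ ω S hS).integrated μ f‖ :=
    crossedSeminorm_regularClass μ ω hS
  -- The two estimates say that each seminorm dominates the other, so the identity of `C_c(G, A)`
  -- and its inverse both extend to the completions.
  exact ⟨(LinearEquiv.refl ℝ C_c(G, A)).extend (toCompl p) (toCompl q)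
    (denseRange_toCompl p)
    ⟨C, fun f => by
      rw [norm_toCompl, norm_toCompl, LinearEquiv.refl_apply, hq]
      exact norm_integrated_regularRep_le μ ω hS hC f⟩
    (denseRange_toCompl q)
    ⟨C * (M * B), fun f => by
      rw [norm_toCompl, norm_toCompl, LinearEquiv.refl_symm, LinearEquiv.refl_apply, hq]
      exact weightedNorm_le_norm_integrated μ ω hS hC hA hLn hB f⟩,
    fun f => LinearEquiv.extend_eq _ _ _ _ _ _ _ f⟩

/-- An isomorphism of completions that is the identity on `V` is bipositive. -/
theorem mem_complCone_iff_of_forall_toCompl {V : Type*} [AddCommGroup V] [Module ℝ V]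
    {p q : Seminorm ℝ V} (Φ : Compl p ≃L[ℝ] Compl q) (hΦ : ∀ v, Φ (toCompl p v) = toCompl q v)
    {C : PointedCone ℝ V} (x : Compl p) : x ∈ complCone p C ↔ Φ x ∈ complCone q C := by
  refine ⟨fun hx => complCone_induction p (isClosed_complCone q C) Φ.continuous
    (fun f hf => ?_) hx, fun hx => ?_⟩
  · rw [hΦ]
    exact toCompl_mem_complCone q hf
  · rw [← Φ.symm_apply_apply x]
    refine complCone_induction q (isClosed_complCone p C) Φ.symm.continuous (fun f hf => ?_) hx
    rw [← hΦ, Φ.symm_apply_apply]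
    exact toCompl_mem_complCone p hf

/-- An isomorphism of completions that is the identity on `V` is multiplicative. -/
theorem map_mulCompl_of_forall_toCompl {V : Type*} [AddCommGroup V] [Module ℝ V]
    {p q : Seminorm ℝ V} (Φ : Compl p →L[ℝ] Compl q) (hΦ : ∀ v, Φ (toCompl p v) = toCompl q v)
    {m : V →ₗ[ℝ] V →ₗ[ℝ] V} (hp : ∃ C, 0 ≤ C ∧ ∀ v w, p (m v w) ≤ C * p v * p w)
    (hq : ∃ C, 0 ≤ C ∧ ∀ v w, q (m v w) ≤ C * q v * q w) (x y : Compl p) :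
    Φ (mulCompl p m hp x y) = mulCompl q m hq (Φ x) (Φ y) := by
  refine (denseRange_toCompl p).induction_on₂ (isClosed_eq (by fun_prop) (by fun_prop))
    (fun f g => ?_) x y
  rw [mulCompl_toCompl, hΦ, hΦ, hΦ, mulCompl_toCompl]

/-- In the isometric case the norm `‖·‖_{1,ω}` is the norm of the crossed product. -/
theorem norm_integrated_regularRep_eq (hA : HasApproxRightIdentity.{w} 1 (univ : Set A))
    (hC : ∀ s, ‖S.act s‖ ≤ 1) {Z : Set (Set G)} {K : Set G} (hK : IsCompact K)
    (hZK : ∀ W ∈ Z, W ⊆ K) (hZ : (𝓝 (1 : G)).HasBasis (fun W => W ∈ Z) id)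
    (hinf : (⨅ W : Z, ⨆ r : (W : Set G), ω r) = 1) (f : C_c(G, A)) :
    ‖(regularRep μ ω S hS).integrated μ f‖ = weightedNorm μ ω A f := by
  refine le_antisymm ((norm_integrated_regularRep_le μ ω hS hC f).trans (one_mul _).le) ?_
  obtain ⟨D, -, hD⟩ := ω.bddOn_compact μ hK
  -- With `C = M = 1` the only loss is the bound c of the weight near e. The infimum 1 need not be
  -- attained, so the estimate is proved for every `c > 1` and c is then sent to 1.
  have h1 : ∀ c : ℝ, 1 < c →
      weightedNorm μ ω A f ≤ c * ‖(regularRep μ ω S hS).integrated μ f‖ := fun c hc => by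
    obtain ⟨W, hW, hWc⟩ := ω.exists_mem_forall_le hD hZK hZ (hinf.trans_lt hc)
    simpa using weightedNorm_le_norm_integrated μ ω hS hC hA hW hWc f
  have h2 : Tendsto (fun c : ℝ => c * ‖(regularRep μ ω S hS).integrated μ f‖) (𝓝[>] 1)
      (𝓝 (1 * ‖(regularRep μ ω S hS).integrated μ f‖)) :=
    (tendsto_id.mul_const _).mono_left nhdsWithin_le_nhds
  rw [one_mul] at h2
  exact ge_of_tendsto h2 (eventually_mem_nhdsWithin.mono h1)

end Regular

end OrderedCrossedProduct

end


/-! ### The main theorem -/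

theorem theorem5p8 {A : Type u} {G : Type v}
    [NonUnitalNormedRing A] [NormedSpace ℝ A] [IsScalarTower ℝ A A] [SMulCommClass ℝ A A]
    [CompleteSpace A]
    [Group G] [TopologicalSpace G] [IsTopologicalGroup G] [LocallyCompactSpace G] [T2Space G]
    [MeasurableSpace G] [BorelSpace G] (μ : Measure G) [μ.IsHaarMeasure] [μ.Regular]
    (S : PreorderedSystem A G) (hS : S.UniformlyBounded) (ω : Weight G)
    (hA : ∃ M : ℝ, HasApproxRightIdentity.{w} M (univ : Set A)) :
    -- `(λ̃, Λ)` is positive and non-degenerate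
    (regularRep μ ω S hS).Positive (beurlingCone μ ω S.cone) ∧
    (regularRep μ ω S hS).Nondegenerate ∧
    -- the isomorphism `Φ : L¹(G, A, ω; α) → (A ⋊_α G)^R` and the embedding
    -- `Ψ : (A ⋊_α G)^R → B(L¹(G, A, ω))`, with `R = {(λ̃, Λ)}`
    ∃ (Φ : BeurlingSpace μ ω A ≃L[ℝ]
        CrossedProduct μ (regularClass μ ω S hS) (uniformlyBounded_regularClass μ ω S hS))
      (Ψ : CrossedProduct μ (regularClass μ ω S hS) (uniformlyBounded_regularClass μ ω S hS) →L[ℝ]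
        (BeurlingSpace μ ω A →L[ℝ] BeurlingSpace μ ω A)),
      -- `Φ` is a bipositive isomorphism of algebras that is the identity on `C_c(G, A)`
      (∀ f : C_c(G, A), Φ (toBeurling μ ω f) = toCrossed μ _ _ f) ∧
      (∀ x y, Φ (beurlingMul μ ω S hS x y) = crossedMul μ _ _ (Φ x) (Φ y)) ∧
      (∀ x, x ∈ beurlingCone μ ω S.cone ↔ Φ x ∈ crossedCone μ _ _) ∧
      -- `Ψ` is a positive topological embedding of algebras that extends `λ̃ ⋊ Λ`
      (∀ f : C_c(G, A), Ψ (toCrossed μ _ _ f) = (regularRep μ ω S hS).integrated μ f) ∧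
      (∀ x y, Ψ (crossedMul μ _ _ x y) = Ψ x * Ψ y) ∧
      IsEmbedding Ψ ∧
      (∀ x ∈ crossedCone μ _ _, Ψ x ∈ operatorCone (beurlingCone μ ω S.cone)) ∧
      -- `Ψ` is bipositive if there is a positive bounded approximate right identity
      ((∃ M : ℝ, HasApproxRightIdentity.{w} M (S.cone : Set A)) →
        ∀ x, Ψ x ∈ operatorCone (beurlingCone μ ω S.cone) → x ∈ crossedCone μ _ _) ∧
      -- the isometric case
      (HasApproxRightIdentity.{w} 1 (univ : Set A) →
        (∀ s a, ‖S.act s a‖ = ‖a‖) →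
        ∀ Z : Set (Set G), (𝓝 (1 : G)).HasBasis (fun W => W ∈ Z) id →
          (∃ K, IsCompact K ∧ ∀ W ∈ Z, W ⊆ K) →
          (⨅ W : Z, ⨆ r : (W : Set G), ω r) = 1 →
          Isometry Φ ∧ Isometry Ψ) := by
  obtain ⟨M, hAM⟩ := hA
  obtain ⟨Φ, hΦ⟩ := exists_beurling_equiv_crossedProduct μ ω hS hAM
  have hpos := mem_complCone_iff_of_forall_toCompl Φ hΦ (C := ccCone S.cone)
  refine ⟨regularRep_positive μ ω hS, regularRep_nondegenerate μ ω hS hAM, Φ,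
    crossedRep μ ω hS, hΦ,
    fun x y => map_mulCompl_of_forall_toCompl Φ.toContinuousLinearMap hΦ _ _ x y, hpos,
    crossedRep_toCrossed μ ω hS, crossedRep_mul μ ω hS,
    (isometry_crossedRep μ ω hS).isEmbedding, fun x hx => crossedRep_mem_operatorCone μ ω hS hx,
    ?_, ?_⟩
  · rintro ⟨M', hA'⟩ x hx
    -- Since Φ is onto and bipositive, the question moves to `Ψ ∘ Φ`, the extension of `λ̃ ⋊ Λ` to
    -- `L¹(G, A, ω)`.
    obtain ⟨y, rfl⟩ := Φ.surjective x
    exact (hpos y).1 (mem_beurlingCone_of_mem_operatorCone μ ω hS hA'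
      (Θ := (crossedRep μ ω hS).comp Φ.toContinuousLinearMap)
      (fun f => (congrArg (crossedRep μ ω hS) (hΦ f)).trans (crossedRep_toCrossed μ ω hS f)) hx)
  · rintro hA1 hiso Z hZ ⟨K, hK, hZK⟩ hinf
    -- Only Φ needs the extra hypotheses: they turn `σ^R` into `‖·‖_{1,ω}` exactly.
    refine ⟨isometry_of_norm_toCompl Φ.toContinuousLinearMap fun f => ?_,
      isometry_crossedRep μ ω hS⟩
    have hC : ∀ s, ‖S.act s‖ ≤ 1 := fun s =>
      (S.act s).opNorm_le_bound zero_le_one fun a => by rw [hiso, one_mul]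
    refine (congrArg norm (hΦ f)).trans ((norm_toCompl _ f).trans ?_)
    exact (crossedSeminorm_regularClass μ ω hS f).trans
      (norm_integrated_regularRep_eq μ ω hS hA1 hC hK hZK hZ hinf f)
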